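/- Let $R$ be a commutative ring and let $(X;\star_1,\dots,\star_r)$ be a multispindle: a set with binary operations that satisfy $x\star_i x=x$ and $(x\star_i y)\star_j z=(x\star_j z)\star_i(y\star_j z)$ for all $i,j$ and $x,y,z\in X$. Let $X$ act on an $R$-module $M$, i.e. let functions $\star_i\colon M\times X\to M$, $R$-linear in the first variable, be given with $(m\star_i x)\star_j y=(m\star_j y)\star_i(x\star_j y)$. Fix weights $a_1,\dots,a_r\in R$. Let $C_n(M;X)=M\otimes R\langle X^{n+1}\rangle$ ($n\ge 0$), with differential $$\partial(m\otimes(x_n,\dots,x_0))=\sum_{k=1}^r a_k\sum_{i=0}^n(-1)^{n-i}(m\star_k x_i)\otimes(x_n\star_k x_i,\dots,x_{i+1}\star_k x_i,x_{i-1},\dots,x_0).$$ Let $CD(M;X)\subset C(M;X)$ be the degenerate subcomplex, generated by the $m\otimes(x_n,\dots,x_0)$ with $x_i=x_{i+1}$ for some $i$, with homology $HD(M;X)$, and let $CN(M;X)=C(M;X)/CD(M;X)$, with homology $HN(M;X)$ (the normalized homology). Let $\widehat C(M;X)$ be the complex $C(M;X)$ augmented by $M$ in degree $-1$ through $C_0(M;X)\to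 M$, $m\otimes x\mapsto\sum_k a_k(m\star_k x)$, and let $\widehat H(M;X)$ be its homology (so $\widehat H_k=0$ for $k<-1$); $X$ acts on $\widehat H_k(M;X)$ through $(m\otimes(x_n,\dots,x_0))\star_k y=(m\star_k y)\otimes(x_n\star_k y,\dots,x_0\star_k y)$. For $p\in\mathbb Z$ let $F^pCD_n(M;X)$ be generated by the $m\otimes(x_n,\dots,x_0)$ with $x_i=x_{i+1}$ for some $i\le p$. These are subcomplexes; they form an exhaustive increasing filtration of $CD(M;X)$ with $F^p=0$ for $p<0$. Theorem. The filtration $F$ gives a first quadrant spectral sequence $(E^r,d^r)_{r\ge 0}$ of $R$-modules, with $d^r$ of bidegree $(-r,r-1)$, namely $$E^r_{pq}=Z^r_{p}/\big(Z^{r-1}_{p-1}+\partial Z^{r-1}_{p+r-1}\big),\qquad Z^r_p=\{z\in F^p\mid\partial z\in F^{p-r}\},$$ (where the quotient is taken in degree $p+q$ of $CD(M;X)$, so that $Z^{r-1}_{p+r-1}$ is taken in degree $p+q+1$), with differentials induced by $\partial$ and isomorphisms $H(E^r,d^r)\cong E^{r+1}$ induced by the inclusions $Z^{r+1}_p\subset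 Z^r_p$. It converges to $HD(M;X)$: with $F^pHD_n=\operatorname{im}(H_n(F^pCD)\to HD_n)$, for every $n$ there is a $p$ with $F^pHD_n=HD_n$, and for all $p,q\ge 0$ and $r>p+q+1$ the differentials from and to $E^r_{pq}$ vanish and $E^r_{pq}\cong F^pHD_{p+q}(M;X)/F^{p-1}HD_{p+q}(M;X)$, by the map that sends the class of a cycle in $F^p$ to its homology class. Its second page is $$E^2_{pq}\cong HN_p\big(\widehat H_{q-2}(M;X);X\big)\qquad(p,q\ge 0),$$ as $R$-modules, the normalized homology (with the same weights) of $X$ with coefficients in the $X$-module $\widehat H_{q-2}(M;X)$. -/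

import Mathlib

open CategoryTheory

set_option linter.unusedSectionVars false

universe uR uI uX uM v

noncomputable section

/-! ### Multispindles and their modules -/

/-- A multispindle: a set `X` with a family of operations `op i`, indexed by `ι`, each of which is
idempotent, and which are mutually (in particular each one self-) distributive from the right. -/
class Multispindle (ι : Type uI) (X : Type uX) where
  op : ι → X → X → X
  idem : ∀ i x, op i x x = x
  distrib : ∀ i j x y z, op j (op i x y) z = op i (op j x z) (op j y z)

/-- An action of a multispindle `X` on an `R`-module `M`; `act i x m` is the element `m ⋆ᵢ x`. -/
structure MultispindleAction (R : Type uR) [CommRing R] (ι : Type uI) (X : Type uX)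
    [Multispindle ι X] (M : Type uM) [AddCommGroup M] [Module R M] where
  act : ι → X → M →ₗ[R] M
  distrib : ∀ i j x y m,
    act j y (act i x m) = act i (Multispindle.op j x y) (act j y m)

/-! ### Sequences, faces, repetitions

A sequence `(x_n, …, x_0)` is encoded as the function `i ↦ x_i` on `Fin (n + 1)`; so position `0` is
the rightmost one. -/

/-- The `i`-th face `(x_n ⋆ x_i, …, x_{i+1} ⋆ x_i, x_{i-1}, …, x_0)` for the operation `k`. -/
def seqFace {ι : Type uI} {X : Type uX} [Multispindle ι X] (k : ι) {n : ℕ} (i : Fin (n + 1))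
    (x : Fin (n + 1) → X) : Fin n → X := fun j =>
  if j.castSucc < i then x j.castSucc else Multispindle.op k (x j.succ) (x i)

/-- There is a repetition `x_i = x_{i+1}` at some position `i ≤ p`. -/
def HasRepetitionUpTo {X : Type uX} {n : ℕ} (p : ℤ) (x : Fin n → X) : Prop :=
  ∃ i : ℕ, (i : ℤ) ≤ p ∧ ∃ h : i + 1 < n, x ⟨i, by omega⟩ = x ⟨i + 1, h⟩

/-- There is a repetition `x_i = x_{i+1}` at some position. -/
def HasRepetition {X : Type uX} {n : ℕ} (x : Fin n → X) : Prop :=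
  ∃ i : ℕ, ∃ h : i + 1 < n, x ⟨i, by omega⟩ = x ⟨i + 1, h⟩

section Faces

variable {ι : Type uI} {X : Type uX} [Multispindle ι X]

lemma seqFace_of_lt (k : ι) {n : ℕ} (i : Fin (n + 1)) (x : Fin (n + 1) → X) (j : Fin n)
    (h : (j : ℕ) < i) : seqFace k i x j = x j.castSucc := by
  have : j.castSucc < i := h
  simp [seqFace, this]

lemma seqFace_of_le (k : ι) {n : ℕ} (i : Fin (n + 1)) (x : Fin (n + 1) → X) (j : Fin n)
    (h : (i : ℕ) ≤ j) : seqFace k i x j = Multispindle.op k (x j.succ) (x i) := by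
  have : ¬ j.castSucc < i := by
    intro h'
    have h'' : (j : ℕ) < i := h'
    omega
  simp [seqFace, this]

lemma seqFace_seqFace (k l : ι) {n : ℕ} (i : Fin (n + 1)) (j : Fin (n + 1)) (h : j ≤ i)
    (x : Fin (n + 2) → X) :
    seqFace k i (seqFace l j.castSucc x) = seqFace l j (seqFace k i.succ x) := by
  have hji : (j : ℕ) ≤ i := h
  funext t
  have e1 : seqFace l j.castSucc x i = Multispindle.op l (x i.succ) (x j.castSucc) :=
    seqFace_of_le l _ x i (by simpa using hji)
  have e2 : seqFace k i.succ x j = x j.castSucc :=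
    seqFace_of_lt k _ x j (by simp; omega)
  rcases lt_or_ge (t : ℕ) j with h1 | h1
  · rw [seqFace_of_lt k i _ t (by omega), seqFace_of_lt l j _ t h1,
      seqFace_of_lt l _ x _ (by simpa using h1), seqFace_of_lt k _ x _ (by simp; omega)]
  · rcases lt_or_ge (t : ℕ) i with h2 | h2
    · rw [seqFace_of_lt k i _ t h2, seqFace_of_le l j _ t h1, e2,
        seqFace_of_le l _ x _ (by simpa using h1), seqFace_of_lt k _ x _ (by simpa using h2)]
      rfl
    · rw [seqFace_of_le k i _ t h2, seqFace_of_le l j _ t h1, e1, e2,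
        seqFace_of_le l _ x _ (by simp; omega), seqFace_of_le k _ x _ (by simpa using h2),
        ← Multispindle.distrib]

lemma seqFace_op (k l : ι) {n : ℕ} (i : Fin (n + 1)) (x : Fin (n + 1) → X) (y : X) :
    seqFace l i (fun j => Multispindle.op k (x j) y) =
      fun j => Multispindle.op k (seqFace l i x j) y := by
  funext t
  rcases lt_or_ge (t : ℕ) i with h | h
  · rw [seqFace_of_lt _ _ _ _ h, seqFace_of_lt _ _ _ _ h]
  · rw [seqFace_of_le _ _ _ _ h, seqFace_of_le _ _ _ _ h, ← Multispindle.distrib]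

/-- The two faces at a repetition agree. -/
lemma seqFace_repetition (k : ι) {n : ℕ} (i : Fin n) (x : Fin (n + 1) → X)
    (h : x i.castSucc = x i.succ) : seqFace k i.castSucc x = seqFace k i.succ x := by
  funext t
  rcases lt_trichotomy (t : ℕ) i with h1 | h1 | h1
  · rw [seqFace_of_lt _ _ _ _ (by simpa using h1), seqFace_of_lt _ _ _ _ (by simp; omega)]
  · obtain rfl : t = i := Fin.ext h1
    rw [seqFace_of_le _ _ _ _ (by simp), seqFace_of_lt _ _ _ _ (by simp), h, Multispindle.idem]
  · rw [seqFace_of_le _ _ _ _ (by simp; omega), seqFace_of_le _ _ _ _ (by simp; omega), h]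

/-- The other faces keep a repetition, at the same position or one step to the right. -/
lemma seqFace_hasRepetitionUpTo (k : ι) {n : ℕ} (i : Fin n) (j : Fin (n + 1))
    (x : Fin (n + 1) → X) (h : x i.castSucc = x i.succ) (h1 : j ≠ i.castSucc) (h2 : j ≠ i.succ)
    (p : ℤ) (hp : (i : ℤ) ≤ p) : HasRepetitionUpTo p (seqFace k j x) := by
  have h1' : (j : ℕ) ≠ i := fun e => h1 (Fin.ext e)
  have h2' : (j : ℕ) ≠ i + 1 := fun e => h2 (Fin.ext e)
  rcases lt_or_gt_of_ne h1' with hj | hj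
  · obtain ⟨i0, hi0⟩ : ∃ i0 : ℕ, (i : ℕ) = i0 + 1 := ⟨i - 1, by omega⟩
    refine ⟨i0, by omega, by omega, ?_⟩
    rw [seqFace_of_le _ _ _ _ (by simp; omega), seqFace_of_le _ _ _ _ (by simp; omega)]
    congr 1
    convert h using 2 <;> (apply Fin.ext; simp; omega)
  · refine ⟨i, hp, by omega, ?_⟩
    rw [seqFace_of_lt _ _ _ _ (by simp; omega), seqFace_of_lt _ _ _ _ (by simp; omega)]
    exact h

end Faces

section

variable {R : Type*} [CommRing R] {M N P : Type*} [AddCommGroup M] [AddCommGroup N]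
  [AddCommGroup P] [Module R M] [Module R N] [Module R P] {κ : Type*}

lemma linearMap_sum_comp (s : Finset κ) (f : κ → N →ₗ[R] P) (g : M →ₗ[R] N) :
    (∑ i ∈ s, f i) ∘ₗ g = ∑ i ∈ s, f i ∘ₗ g := by
  ext x; simp

lemma linearMap_comp_sum (s : Finset κ) (f : κ → M →ₗ[R] N) (g : N →ₗ[R] P) :
    g ∘ₗ (∑ i ∈ s, f i) = ∑ i ∈ s, g ∘ₗ f i := by
  ext x; simp

end

/-! ### The distributive chain complexes with coefficients -/

namespace MultispindleAction

variable {R : Type uR} [CommRing R] {ι : Type uI} [Fintype ι] {X : Type uX}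
  [Multispindle ι X] {M : Type uM} [AddCommGroup M] [Module R M]

/-- The face map `m ⊗ x ↦ (m ⋆ₖ x_i) ⊗ d_i x` of the operation `k`. Here and below the module
`M ⊗ R⟨X^n⟩` is the module of finitely supported functions `X^n → M`, and `m ⊗ x` is
`Finsupp.single x m`. -/
def faceMap (A : MultispindleAction R ι X M) (k : ι) {n : ℕ} (i : Fin (n + 1)) :
    ((Fin (n + 1) → X) →₀ M) →ₗ[R] ((Fin n → X) →₀ M) :=
  Finsupp.lsum R fun x => Finsupp.lsingle (seqFace k i x) ∘ₗ A.act k (x i)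

/-- The weighted sum over all operations of the `i`-th face maps. -/
def totalFaceMap (A : MultispindleAction R ι X M) (a : ι → R) {n : ℕ} (i : Fin (n + 1)) :
    ((Fin (n + 1) → X) →₀ M) →ₗ[R] ((Fin n → X) →₀ M) :=
  ∑ k, a k • A.faceMap k i

/-- The multiterm differential `∑ₖ aₖ ∑ᵢ (-1)^(n-i) dᵢ` on `M ⊗ R⟨X^(n+1)⟩`. For `n = 0` it sends
`m ⊗ x_0` to `∑ₖ aₖ (m ⋆ₖ x_0)`, the compound action, under `M ⊗ R⟨X^0⟩ = M`. -/
def differential (A : MultispindleAction R ι X M) (a : ι → R) (n : ℕ) :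
    ((Fin (n + 1) → X) →₀ M) →ₗ[R] ((Fin n → X) →₀ M) :=
  ∑ i : Fin (n + 1), (-1 : R) ^ (n - (i : ℕ)) • A.totalFaceMap a i

lemma faceMap_single (A : MultispindleAction R ι X M) (k : ι) {n : ℕ} (i : Fin (n + 1))
    (x : Fin (n + 1) → X) (m : M) :
    A.faceMap k i (Finsupp.single x m) = Finsupp.single (seqFace k i x) (A.act k (x i) m) := by
  simp [faceMap]

lemma totalFaceMap_single (A : MultispindleAction R ι X M) (a : ι → R) {n : ℕ} (i : Fin (n + 1))
    (x : Fin (n + 1) → X) (m : M) :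
    A.totalFaceMap a i (Finsupp.single x m) =
      ∑ k, a k • Finsupp.single (seqFace k i x) (A.act k (x i) m) := by
  simp [totalFaceMap, faceMap_single]

lemma faceMap_comp (A : MultispindleAction R ι X M) (k l : ι) {n : ℕ} (i j : Fin (n + 1))
    (h : j ≤ i) :
    A.faceMap k i ∘ₗ A.faceMap l j.castSucc = A.faceMap l j ∘ₗ A.faceMap k i.succ := by
  have hji : (j : ℕ) ≤ i := h
  apply Finsupp.lhom_ext
  intro x m
  simp only [LinearMap.comp_apply, faceMap_single]
  rw [seqFace_seqFace k l i j h x, seqFace_of_le l _ x i (by simpa using hji),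
    seqFace_of_lt k _ x j (by simp; omega), ← A.distrib]

lemma totalFaceMap_comp (A : MultispindleAction R ι X M) (a : ι → R) {n : ℕ} (i j : Fin (n + 1))
    (h : j ≤ i) :
    A.totalFaceMap a i ∘ₗ A.totalFaceMap a j.castSucc =
      A.totalFaceMap a j ∘ₗ A.totalFaceMap a i.succ := by
  simp only [totalFaceMap, linearMap_sum_comp, linearMap_comp_sum, LinearMap.smul_comp,
    LinearMap.comp_smul, Finset.smul_sum]
  rw [Finset.sum_comm]
  refine Finset.sum_congr rfl fun l _ => Finset.sum_congr rfl fun k _ => ?_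
  rw [A.faceMap_comp _ _ i j h, smul_comm]

lemma differential_comp (A : MultispindleAction R ι X M) (a : ι → R) (n : ℕ) :
    A.differential a n ∘ₗ A.differential a (n + 1) = 0 := by
  have e : ∀ m : ℕ, A.differential a m =
      (-1 : R) ^ m • ∑ i : Fin (m + 1), (-1 : R) ^ (i : ℕ) • A.totalFaceMap a i := by
    intro m
    rw [differential, Finset.smul_sum]
    refine Finset.sum_congr rfl fun i _ => ?_
    rw [smul_smul, ← pow_add]
    congr 1
    have : m + (i : ℕ) = (m - (i : ℕ)) + 2 * i := by omega
    rw [this, pow_add, pow_mul]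
    simp
  rw [e, e, LinearMap.smul_comp, LinearMap.comp_smul]
  suffices h : (∑ i : Fin (n + 1), (-1 : R) ^ (i : ℕ) • A.totalFaceMap a i) ∘ₗ
      (∑ i : Fin (n + 2), (-1 : R) ^ (i : ℕ) • A.totalFaceMap a i) = 0 by
    rw [h]; simp
  simp only [linearMap_sum_comp, linearMap_comp_sum, LinearMap.smul_comp, LinearMap.comp_smul,
    Finset.smul_sum]
  rw [Finset.sum_comm, ← Finset.sum_product']
  let P := Fin (n + 1) × Fin (n + 2)
  let S : Finset P := {ij : P | (ij.2 : ℕ) ≤ (ij.1 : ℕ)}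
  rw [Finset.univ_product_univ, ← Finset.sum_add_sum_compl S, ← eq_neg_iff_add_eq_zero,
    ← Finset.sum_neg_distrib]
  let φ : ∀ ij : P, ij ∈ S → P := fun ij hij =>
    (Fin.castLT ij.2 (lt_of_le_of_lt (Finset.mem_filter.mp hij).right (Fin.is_lt ij.1)), ij.1.succ)
  apply Finset.sum_bij φ
  · intro ij hij
    simp_rw [S, φ, Finset.compl_filter, Finset.mem_filter_univ, Fin.val_succ,
      Fin.val_castLT] at hij ⊢
    omega
  · rintro ⟨i, j⟩ hij ⟨i', j'⟩ hij' h
    have h1 : i = i' := Fin.succ_inj.1 (congrArg Prod.snd h)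
    have h2 : (j : ℕ) = j' := congrArg (fun t : P => (t.1 : ℕ)) h
    rw [h1, Fin.ext h2]
  · rintro ⟨i', j'⟩ hij'
    simp_rw [S, Finset.compl_filter, Finset.mem_filter_univ, not_le] at hij'
    refine ⟨(j'.pred ?_, Fin.castSucc i'), ?_, ?_⟩
    · rintro rfl
      simp at hij'
    · simp [S]
      omega
    · simp [φ]
  · rintro ⟨i, j⟩ hij
    simp only [S, Finset.mem_filter_univ] at hij
    simp only [φ]
    have hj : j = (Fin.castLT j (lt_of_le_of_lt hij i.is_lt)).castSucc := by simp
    have hc := A.totalFaceMap_comp a i (Fin.castLT j (lt_of_le_of_lt hij i.is_lt)) hij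
    rw [← hj] at hc
    rw [hc, smul_smul, smul_smul, ← neg_smul]
    congr 1
    simp [pow_succ]
    ring

/-- The augmented complex of `M`: the module in degree `n - 1` of the augmented complex sits in
degree `n` here and is `M ⊗ R⟨X^n⟩`; in particular degree `0` is `M` itself. -/
def augComplex (A : MultispindleAction R ι X M) (a : ι → R) :
    ChainComplex (ModuleCat.{max uX uM} R) ℕ :=
  ChainComplex.of (fun n => ModuleCat.of R ((Fin n → X) →₀ M))
    (fun n => ModuleCat.ofHom (A.differential a n))
    (fun n => by
      rw [← ModuleCat.ofHom_comp, A.differential_comp]; rfl)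

/-- The distributive chain complex `C(M; X)`, with `C_n(M; X) = M ⊗ R⟨X^(n+1)⟩`. -/
def chainComplex (A : MultispindleAction R ι X M) (a : ι → R) :
    ChainComplex (ModuleCat.{max uX uM} R) ℕ :=
  ChainComplex.truncate.obj (A.augComplex a)

lemma augComplex_d (A : MultispindleAction R ι X M) (a : ι → R) (n : ℕ) :
    (A.augComplex a).d (n + 1) n = ModuleCat.ofHom (A.differential a n) :=
  ChainComplex.of_d (fun n => ModuleCat.of R ((Fin n → X) →₀ M))
    (fun n => ModuleCat.ofHom (A.differential a n)) n

lemma chainComplex_d (A : MultispindleAction R ι X M) (a : ι → R) (n : ℕ) :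
    (A.chainComplex a).d (n + 1) n = ModuleCat.ofHom (A.differential a (n + 1)) :=
  A.augComplex_d a (n + 1)

end MultispindleAction

/-! ### Subcomplexes and quotient complexes -/

section Subcomplex

variable {R : Type uR} [CommRing R] (K : ChainComplex (ModuleCat.{v} R) ℕ)
  (S : ∀ n, Submodule R (K.X n)) (hS : ∀ i j, S i ≤ (S j).comap (K.d i j).hom)

/-- The subcomplex given by submodules that are stable under the differential. -/
def subcomplex : ChainComplex (ModuleCat.{v} R) ℕ where
  X n := ModuleCat.of R (S n)
  d i j := ModuleCat.ofHom ((K.d i j).hom.restrict (hS i j))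
  shape i j h := by
    refine ModuleCat.hom_ext (LinearMap.ext fun x => Subtype.ext ?_)
    change (K.d i j).hom x.1 = 0
    rw [K.shape i j h]
    rfl
  d_comp_d' i j k _ _ := by
    refine ModuleCat.hom_ext (LinearMap.ext fun x => Subtype.ext ?_)
    exact congrArg (fun f => f.hom x.1) (K.d_comp_d i j k)

/-- The quotient of a complex by a subcomplex. -/
def quotientComplex : ChainComplex (ModuleCat.{v} R) ℕ where
  X n := ModuleCat.of R (K.X n ⧸ S n)
  d i j := ModuleCat.ofHom ((S i).mapQ (S j) (K.d i j).hom (hS i j))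
  shape i j h := by
    ext x
    simp [K.shape i j h]
  d_comp_d' i j k _ _ := by
    refine ModuleCat.hom_ext (Submodule.linearMap_qext _ (LinearMap.ext fun x => ?_))
    exact congrArg (fun f => (S k).mkQ (f.hom x)) (K.d_comp_d i j k)

end Subcomplex

/-! ### Filtered complexes and their spectral sequences -/

/-- An increasing exhaustive filtration `F^0 ⊆ F^1 ⊆ ⋯` of a chain complex by subcomplexes, indexed
by the integers with `F^p = 0` for `p < 0`. -/
structure ChainFiltration {R : Type uR} [CommRing R] (K : ChainComplex (ModuleCat.{v} R) ℕ) where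
  sub : ℤ → ∀ n, Submodule R (K.X n)
  mono : ∀ p n, sub p n ≤ sub (p + 1) n
  map_d : ∀ p i j, sub p i ≤ (sub p j).comap (K.d i j).hom
  eq_bot : ∀ p, p < 0 → ∀ n, sub p n = ⊥
  exhaustive : ∀ n (x : K.X n), ∃ p, x ∈ sub p n

/-- First quadrant homological spectral sequences of `R`-modules, starting with the `0`-th page: the
differential of the `r`-th page has bidegree `(-r, r - 1)`. -/
abbrev FirstQuadrantSpectralSequence (R : Type uR) [CommRing R] :=
  SpectralSequence (ModuleCat.{v} R)
    (fun r => ComplexShape.spectralSequenceNat ((-r, r - 1) : ℤ × ℤ)) 0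

lemma int_zero_le_two : (0 : ℤ) ≤ 2 := by norm_num

namespace ChainFiltration

variable {R : Type uR} [CommRing R] {K : ChainComplex (ModuleCat.{v} R) ℕ}

/-- The chains `z ∈ F^p K_n` with `d z ∈ F^(p-r)`. -/
def Z (F : ChainFiltration K) (r p : ℤ) (n : ℕ) : Submodule R (K.X n) :=
  F.sub p n ⊓ ⨅ j, (F.sub (p - r) j).comap (K.d n j).hom

/-- The submodule `Z^(r-1)_(p-1) + d Z^(r-1)_(p+r-1)` of `K_n`. -/
def B (F : ChainFiltration K) (r p : ℤ) (n : ℕ) : Submodule R (K.X n) :=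
  F.Z (r - 1) (p - 1) n ⊔ (F.Z (r - 1) (p + r - 1) (n + 1)).map (K.d (n + 1) n).hom

/-- The data identifying `E` with the spectral sequence of the filtration `F`: isomorphisms
`E^r_{pq} = Z^r_p / B^r_p` in degree `p + q` (given as surjections `Z^r_p → E^r_{pq}` with kernel
`B^r_p`) under which the differential of every page is induced by the differential of the complex,
and the isomorphisms `H(E^r) ≅ E^(r+1)` are induced by the inclusions `Z^(r+1)_p ⊆ Z^r_p`. -/
structure IsSpectralSequence (F : ChainFiltration K)
    (E : FirstQuadrantSpectralSequence.{uR, v} R) where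
  proj (r : ℤ) (hr : 0 ≤ r) (p q : ℕ) : F.Z r p (p + q) →ₗ[R] (E.page r hr).X (p, q)
  proj_surjective (r : ℤ) (hr : 0 ≤ r) (p q : ℕ) : Function.Surjective (proj r hr p q)
  ker_proj (r : ℤ) (hr : 0 ≤ r) (p q : ℕ) :
    LinearMap.ker (proj r hr p q) = (F.B r p (p + q)).comap (F.Z r p (p + q)).subtype
  d_proj (r : ℤ) (hr : 0 ≤ r) (p q p' q' : ℕ) (_ : (p : ℤ) - r = p')
    (_ : (q : ℤ) + (r - 1) = q') (z : F.Z r p (p + q)) (z' : F.Z r p' (p' + q'))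
    (_ : (z' : K.X (p' + q')) = K.d (p + q) (p' + q') (z : K.X (p + q))) :
    (E.page r hr).d (p, q) (p', q') (proj r hr p q z) = proj r hr p' q' z'
  iso_proj (r : ℤ) (hr : 0 ≤ r) (p q : ℕ) (z : F.Z (r + 1) p (p + q)) (z' : F.Z r p (p + q))
    (_ : (z' : K.X (p + q)) = z) (c : (E.page r hr).cycles (p, q))
    (_ : (E.page r hr).iCycles (p, q) c = proj r hr p q z') :
    (E.iso r (r + 1) (p, q) rfl hr).hom ((E.page r hr).homologyπ (p, q) c) =
      proj (r + 1) (by omega) p q z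

/-- The induced filtration of the homology: `F^p H_n` consists of the classes of the cycles of
`K_n` that lie in `F^p`, i.e. it is the image of the homology of `F^p`. -/
def homologyFiltration (F : ChainFiltration K) (p : ℤ) (n : ℕ) : Submodule R (K.homology n) :=
  ((F.sub p n).comap (K.iCycles n).hom).map (K.homologyπ n).hom

/-- The graded piece `F^p H_n / F^(p-1) H_n`. -/
abbrev grHomology (F : ChainFiltration K) (p : ℤ) (n : ℕ) : Type v :=
  F.homologyFiltration p n ⧸ (F.homologyFiltration (p - 1) n).submoduleOf (F.homologyFiltration p n)

/-- The spectral sequence `E` of the filtration `F` converges to `H(K)` with the induced filtration: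
this filtration is bounded, all differentials from and to `E^r_{pq}` vanish for `r > p + q + 1`, and
for these `r` the map that sends the class of a cycle in `F^p` to its homology class is an
isomorphism `E^r_{pq} ≅ F^p H_{p+q} / F^(p-1) H_{p+q}`. -/
def ConvergesToHomology (F : ChainFiltration K) {E : FirstQuadrantSpectralSequence.{uR, v} R}
    (hE : F.IsSpectralSequence E) : Prop :=
  (∀ n, ∃ p, F.homologyFiltration p n = ⊤) ∧
  ∀ (p q : ℕ) (r : ℤ) (hr : (p : ℤ) + q + 1 < r),
    (∀ pq', (E.page r (by omega)).d (p, q) pq' = 0 ∧ (E.page r (by omega)).d pq' (p, q) = 0) ∧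
    ∃ e : (E.page r (by omega)).X (p, q) ≃ₗ[R] F.grHomology p (p + q),
      ∀ (z : F.Z r p (p + q)) (c : K.cycles (p + q)) (w : F.homologyFiltration p (p + q)),
        K.iCycles (p + q) c = (z : K.X (p + q)) →
        (w : K.homology (p + q)) = K.homologyπ (p + q) c →
        e (hE.proj r (by omega) p q z) = Submodule.Quotient.mk w

end ChainFiltration

/-! ### Degenerate and normalized complexes, and the action on homology -/

namespace MultispindleAction

variable {R : Type uR} [CommRing R] {ι : Type uI} [Fintype ι] {X : Type uX}
  [Multispindle ι X] {M : Type uM} [AddCommGroup M] [Module R M]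

/-- The submodule of `C_n(M; X)` generated by the `m ⊗ x` with a repetition in `x`. -/
def degenerateSub (A : MultispindleAction R ι X M) (a : ι → R) (n : ℕ) :
    Submodule R ((A.chainComplex a).X n) :=
  Finsupp.supported M R {x : Fin (n + 1) → X | HasRepetition x}

/-- The submodule of `C_n(M; X)` generated by the `m ⊗ x` with a repetition in `x` at position `p`
or closer to the right. -/
def repetitionSub (A : MultispindleAction R ι X M) (a : ι → R) (p : ℤ) (n : ℕ) :
    Submodule R ((A.chainComplex a).X n) :=
  Finsupp.supported M R {x : Fin (n + 1) → X | HasRepetitionUpTo p x}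

lemma differential_mem (A : MultispindleAction R ι X M) (a : ι → R) (p : ℤ) (n : ℕ)
    (f : (Fin (n + 1) → X) →₀ M)
    (hf : f ∈ Finsupp.supported M R {x : Fin (n + 1) → X | HasRepetitionUpTo p x}) :
    A.differential a n f ∈ Finsupp.supported M R {x : Fin n → X | HasRepetitionUpTo p x} := by
  rw [← Finsupp.sum_single f, Finsupp.sum, map_sum]
  refine Submodule.sum_mem _ fun x hx => ?_
  obtain ⟨i, hip, hi, hxi⟩ := (Finsupp.mem_supported R f).1 hf hx
  generalize f x = m
  let i' : Fin n := ⟨i, by omega⟩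
  have hxi' : x i'.castSucc = x i'.succ := hxi
  have hne : i'.castSucc ≠ i'.succ := by
    intro h
    have := congrArg Fin.val h
    simp at this
  simp only [differential, LinearMap.sum_apply, LinearMap.smul_apply]
  rw [← Finset.add_sum_erase _ _ (Finset.mem_univ i'.castSucc),
    ← Finset.add_sum_erase _ _ (Finset.mem_erase.2 ⟨hne.symm, Finset.mem_univ i'.succ⟩), ← add_assoc]
  refine Submodule.add_mem _ ?_ (Submodule.sum_mem _ fun j hj => ?_)
  · have e : A.totalFaceMap a i'.castSucc (Finsupp.single x m) =
        A.totalFaceMap a i'.succ (Finsupp.single x m) := by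
      simp only [totalFaceMap_single]
      refine Finset.sum_congr rfl fun k _ => ?_
      rw [seqFace_repetition k i' x hxi', hxi']
    have e2 : n - (i'.castSucc : ℕ) = n - (i'.succ : ℕ) + 1 := by
      simp [i']; omega
    rw [e, e2, pow_succ, ← add_smul]
    simp
  · simp only [Finset.mem_erase, Finset.mem_univ, and_true] at hj
    refine Submodule.smul_mem _ _ ?_
    rw [totalFaceMap_single]
    refine Submodule.sum_mem _ fun k _ => Submodule.smul_mem _ _ ?_
    exact Finsupp.single_mem_supported R _
      (seqFace_hasRepetitionUpTo k i' j x hxi' hj.2 hj.1 p hip)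

lemma hasRepetition_iff {n : ℕ} (x : Fin (n + 1) → X) :
    HasRepetition x ↔ HasRepetitionUpTo (n : ℤ) x :=
  ⟨fun ⟨i, h, e⟩ => ⟨i, by omega, h, e⟩, fun ⟨i, _, h, e⟩ => ⟨i, h, e⟩⟩

lemma repetitionSub_mono (A : MultispindleAction R ι X M) (a : ι → R) {p p' : ℤ} (h : p ≤ p')
    (n : ℕ) : A.repetitionSub a p n ≤ A.repetitionSub a p' n :=
  Finsupp.supported_mono fun _ ⟨i, h1, h2⟩ => ⟨i, h1.trans h, h2⟩

lemma repetitionSub_le_degenerateSub (A : MultispindleAction R ι X M) (a : ι → R) (p : ℤ) (n : ℕ) :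
    A.repetitionSub a p n ≤ A.degenerateSub a n :=
  Finsupp.supported_mono fun _ ⟨i, _, h2⟩ => ⟨i, h2⟩

lemma degenerateSub_le_repetitionSub (A : MultispindleAction R ι X M) (a : ι → R) (n : ℕ) :
    A.degenerateSub a n ≤ A.repetitionSub a n n :=
  Finsupp.supported_mono fun x hx => (hasRepetition_iff x).1 hx

lemma repetitionSub_map_d (A : MultispindleAction R ι X M) (a : ι → R) (p : ℤ) (i j : ℕ) :
    A.repetitionSub a p i ≤ (A.repetitionSub a p j).comap ((A.chainComplex a).d i j).hom := by
  intro f hf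
  by_cases h : j + 1 = i
  · subst h
    rw [Submodule.mem_comap, chainComplex_d]
    exact A.differential_mem a p (j + 1) f hf
  · rw [Submodule.mem_comap, (A.chainComplex a).shape i j (by simpa using h)]
    exact Submodule.zero_mem _

lemma degenerateSub_map_d (A : MultispindleAction R ι X M) (a : ι → R) (i j : ℕ) :
    A.degenerateSub a i ≤ (A.degenerateSub a j).comap ((A.chainComplex a).d i j).hom := fun _ hf =>
  A.repetitionSub_le_degenerateSub a i j
    (A.repetitionSub_map_d a i i j (A.degenerateSub_le_repetitionSub a i hf))

/-- The degenerate complex `CD(M; X)`. -/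
def degenerateComplex (A : MultispindleAction R ι X M) (a : ι → R) :
    ChainComplex (ModuleCat.{max uX uM} R) ℕ :=
  subcomplex (A.chainComplex a) (A.degenerateSub a) (A.degenerateSub_map_d a)

/-- The normalized complex `CN(M; X) = C(M; X) / CD(M; X)`. -/
def normalizedComplex (A : MultispindleAction R ι X M) (a : ι → R) :
    ChainComplex (ModuleCat.{max uX uM} R) ℕ :=
  quotientComplex (A.chainComplex a) (A.degenerateSub a) (A.degenerateSub_map_d a)

/-- The filtration of `CD(M; X)` by the position of the rightmost repetition. -/
def repetitionFiltration (A : MultispindleAction R ι X M) (a : ι → R) :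
    ChainFiltration (A.degenerateComplex a) where
  sub p n := (A.repetitionSub a p n).comap (A.degenerateSub a n).subtype
  mono p n := Submodule.comap_mono (A.repetitionSub_mono a (by omega) n)
  map_d p i j _ hx := A.repetitionSub_map_d a p i j hx
  eq_bot p hp n := by
    have h0 : {x : Fin (n + 1) → X | HasRepetitionUpTo p x} = ∅ := by
      ext y
      simp only [Set.mem_ofPred_eq, Set.mem_empty_iff_false, iff_false]
      rintro ⟨i, hi, -⟩
      omega
    have h1 : A.repetitionSub a p n = ⊥ :=
      (congrArg (Finsupp.supported M R) h0).trans Finsupp.supported_empty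
    rw [h1]
    exact (Submodule.comap_bot _).trans (Submodule.ker_subtype _)
  exhaustive n x := ⟨n, A.degenerateSub_le_repetitionSub a n x.2⟩

/-- The action `(m ⊗ x) ⋆ₖ y = (m ⋆ₖ y) ⊗ (x ⋆ₖ y)` on chains, with `X` acting on each entry. -/
def chainAct (A : MultispindleAction R ι X M) (k : ι) (y : X) (n : ℕ) :
    ((Fin n → X) →₀ M) →ₗ[R] ((Fin n → X) →₀ M) :=
  Finsupp.lsum R fun x => Finsupp.lsingle (fun j => Multispindle.op k (x j) y) ∘ₗ A.act k y

lemma chainAct_single (A : MultispindleAction R ι X M) (k : ι) (y : X) (n : ℕ) (x : Fin n → X)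
    (m : M) : A.chainAct k y n (Finsupp.single x m) =
      Finsupp.single (fun j => Multispindle.op k (x j) y) (A.act k y m) := by
  simp [chainAct]

lemma chainAct_comp_faceMap (A : MultispindleAction R ι X M) (k l : ι) (y : X) {n : ℕ}
    (i : Fin (n + 1)) :
    A.chainAct k y n ∘ₗ A.faceMap l i = A.faceMap l i ∘ₗ A.chainAct k y (n + 1) := by
  apply Finsupp.lhom_ext
  intro x m
  simp only [LinearMap.comp_apply, faceMap_single, chainAct_single]
  rw [seqFace_op, A.distrib]

lemma chainAct_comp_differential (A : MultispindleAction R ι X M) (a : ι → R) (k : ι) (y : X)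
    (n : ℕ) :
    A.chainAct k y n ∘ₗ A.differential a n = A.differential a n ∘ₗ A.chainAct k y (n + 1) := by
  simp only [differential, totalFaceMap, linearMap_sum_comp, linearMap_comp_sum,
    LinearMap.smul_comp, LinearMap.comp_smul, chainAct_comp_faceMap]

/-- The action of an element of `X` on the augmented complex, as a chain map. -/
def augComplexAct (A : MultispindleAction R ι X M) (a : ι → R) (k : ι) (y : X) :
    A.augComplex a ⟶ A.augComplex a where
  f n := ModuleCat.ofHom (A.chainAct k y n)
  comm' i j h := by
    obtain rfl : j + 1 = i := h
    rw [augComplex_d]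
    exact congrArg ModuleCat.ofHom (A.chainAct_comp_differential a k y j).symm

lemma augComplexAct_comp (A : MultispindleAction R ι X M) (a : ι → R) (i j : ι) (x y : X) :
    A.augComplexAct a i x ≫ A.augComplexAct a j y =
      A.augComplexAct a j y ≫ A.augComplexAct a i (Multispindle.op j x y) := by
  apply HomologicalComplex.hom_ext
  intro n
  refine ModuleCat.hom_ext ?_
  apply Finsupp.lhom_ext
  intro s m
  change A.chainAct j y n (A.chainAct i x n (Finsupp.single s m)) =
    A.chainAct i (Multispindle.op j x y) n (A.chainAct j y n (Finsupp.single s m))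
  simp only [chainAct_single]
  rw [A.distrib]
  congr 1
  funext t
  rw [Multispindle.distrib]

/-- The induced action of `X` on the homology of the augmented complex. -/
def homologyAction (A : MultispindleAction R ι X M) (a : ι → R) (n : ℕ) :
    MultispindleAction R ι X ((A.augComplex a).homology n) where
  act k y := (HomologicalComplex.homologyMap (A.augComplexAct a k y) n).hom
  distrib i j x y m := by
    have h := congrArg (fun f => HomologicalComplex.homologyMap f n)
      (A.augComplexAct_comp a i j x y)
    simp only [HomologicalComplex.homologyMap_comp] at h
    exact congrArg (fun f => f.hom m) h

/-- The augmented homology of `M` in degree `k`, for any integer `k`; it is `0` for `k < -1`. -/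
def augHomology (A : MultispindleAction R ι X M) (a : ι → R) : ℤ → ModuleCat.{max uX uM} R
  | Int.ofNat n => (A.augComplex a).homology (n + 1)
  | Int.negSucc 0 => (A.augComplex a).homology 0
  | Int.negSucc (_ + 1) => ModuleCat.of R PUnit

/-- The action of `X` on the augmented homology of `M`. -/
def augHomologyAction (A : MultispindleAction R ι X M) (a : ι → R) :
    (k : ℤ) → MultispindleAction R ι X (A.augHomology a k)
  | Int.ofNat n => A.homologyAction a (n + 1)
  | Int.negSucc 0 => A.homologyAction a 0
  | Int.negSucc (_ + 1) => { act := fun _ _ => LinearMap.id, distrib := fun _ _ _ _ _ => rfl }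

/-- The normalized homology `HN_n(M; X)` with weights `a`. -/
def normalizedHomology (A : MultispindleAction R ι X M) (a : ι → R) (n : ℕ) :
    ModuleCat.{max uX uM} R :=
  (A.normalizedComplex a).homology n

end MultispindleAction

end

noncomputable section

/-! ### Elementwise homology of complexes of modules -/

section HomologyElements

variable {R : Type uR} [CommRing R] {κ : Type*} {c : ComplexShape κ}
  (K : HomologicalComplex (ModuleCat.{v} R) c) (i : κ)

/-! Modulo `F^(p-1)`, a generator of `F^p` in degree `p + q` has the form `m ⊗ (u, y_p, y_p, …,
y_0)`, where `y` has no repetition and `u` has length `s = q - 1`. In its boundary the two faces at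
the repetition agree and carry opposite signs, so they cancel. A face at `y_i` with `i < p` acts on
both copies of `y_p`, moves the repetition to position `p - 1`, and so falls into `F^(p-1)`. The
faces at the entries of `u` assemble to the differential of the augmented complex
(`differential_dupMap_succ`). Hence `E^1_{pq}` is a sum of copies of the augmented homology in
degree `q - 2`, one for each repetition-free `y`, which is the degree `p` part of the normalized
complex with coefficients in that homology (`exists_firstPageMap`).

On `E^1` only the faces at `y_i` with `i < p` survive (`dZ_dupZ_single`). Compared with the
differential of the normalized complex, the face at `y_p` is missing and all signs differ by
`(-1)^q`. The missing face is the compound action `∑ a_k (h ⋆_k y_p)` on augmented homology. It is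
zero, because appending `y_p` on the right is, up to sign, a null homotopy of that action
(`sum_homologyAction_eq_zero`). The common sign does not affect homology, so `dupNorm_lowerCycles`
yields the second page. The row `q = 0` vanishes: a sequence of length `p + 1` has no room for a
repetition at position `p`.

The spectral sequence is built by hand from the quotients `Z^r_p / B^r_p`. Besides the filtration
axioms this needs only `F^p K_n = K_n` for `n ≤ p`, which deals with differentials that would enter
from or leave to the outside of the first quadrant. Isomorphisms between subquotients come from
`exists_linearMap_of_correspondence`: a third module maps to both sides with matching kernels, and
no inverse has to be written down.

Degree `s` of `augComplex` is degree `s - 1` of the augmented complex, so row `q = s + 1` involves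
`(A.augComplex a).homology s`. -/

lemma iCycles_injective_of_modules : Function.Injective (K.iCycles i) :=
  (ModuleCat.mono_iff_injective _).1 inferInstance

lemma homologyπ_surjective_of_modules : Function.Surjective (K.homologyπ i) :=
  (ModuleCat.epi_iff_surjective _).1 inferInstance

lemma d_iCycles_apply (j : κ) (x : K.cycles i) : K.d i j (K.iCycles i x) = 0 := by
  have := congrArg (fun f => f.hom x) (K.iCycles_d i j)
  exact this

lemma exists_iCycles_eq {x : K.X i} (hx : ∀ j, K.d i j x = 0) : ∃ z, K.iCycles i z = x := by
  let k : ModuleCat.of R (LinearMap.ker (K.d i (c.next i)).hom) ⟶ K.X i :=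
    ModuleCat.ofHom (Submodule.subtype _)
  have hk : k ≫ K.d i (c.next i) = 0 := by
    ext y
    exact y.2
  refine ⟨K.liftCycles k _ rfl hk ⟨x, hx _⟩, ?_⟩
  have := congrArg (fun f => f.hom ⟨x, hx _⟩) (K.liftCycles_i k _ rfl hk)
  exact this

lemma homologyπ_toCycles_apply (j : κ) (w : K.X j) : K.homologyπ i (K.toCycles j i w) = 0 := by
  have := congrArg (fun f => f.hom w) (K.toCycles_comp_homologyπ j i)
  exact this

lemma iCycles_toCycles_apply (j : κ) (w : K.X j) :
    K.iCycles i (K.toCycles j i w) = K.d j i w := by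
  have := congrArg (fun f => f.hom w) (K.toCycles_i j i)
  exact this

/-- Homology is the cokernel of `toCycles`, and exactness at the cycles can be tested on elements.
-/
lemma homologyπ_eq_zero_iff (z : K.cycles i) :
    K.homologyπ i z = 0 ↔ ∃ j w, K.d j i w = K.iCycles i z := by
  constructor
  · intro h
    have hex : (ShortComplex.mk _ _ (K.toCycles_comp_homologyπ (c.prev i) i)).Exact :=
      ShortComplex.exact_of_g_is_cokernel _ (K.homologyIsCokernel (c.prev i) i rfl)
    obtain ⟨w, hw⟩ := (ShortComplex.moduleCat_exact_iff _).1 hex z h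
    refine ⟨_, w, ?_⟩
    rw [← hw]
    exact (iCycles_toCycles_apply K i _ w).symm
  · rintro ⟨j, w, h⟩
    rw [← iCycles_toCycles_apply] at h
    rw [← iCycles_injective_of_modules K i h, homologyπ_toCycles_apply]

end HomologyElements

/-! ### Isomorphisms from correspondences -/

section Span

variable {R : Type*} [CommRing R] {G L Z : Type*} [AddCommGroup G] [AddCommGroup L]
  [AddCommGroup Z] [Module R G] [Module R L] [Module R Z]

/-- A correspondence `L ← G → Z` with matching kernels gives an isomorphism `Z / B ≅ L`. -/
lemma exists_linearMap_of_correspondence (α : G →ₗ[R] L) (β : G →ₗ[R] Z) (B : Submodule R Z)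
    (hα : Function.Surjective α) (hβ : ∀ z, ∃ g, z - β g ∈ B) (hk : ∀ g, α g = 0 ↔ β g ∈ B) :
    ∃ θ : Z →ₗ[R] L, Function.Surjective θ ∧ LinearMap.ker θ = B ∧ ∀ g, θ (β g) = α g := by
  have hπ : Function.Surjective (B.mkQ ∘ₗ β) := by
    intro z
    obtain ⟨z, rfl⟩ := B.mkQ_surjective z
    obtain ⟨g, hg⟩ := hβ z
    exact ⟨g, ((Submodule.Quotient.eq B).2 hg).symm⟩
  have hker : LinearMap.ker (B.mkQ ∘ₗ β) = LinearMap.ker α := by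
    ext g
    simp [hk]
  -- Both `Z ⧸ B` and `L` are the quotient of `G` by the same kernel.
  let e : (Z ⧸ B) ≃ₗ[R] L := ((B.mkQ ∘ₗ β).quotKerEquivOfSurjective hπ).symm ≪≫ₗ
    Submodule.quotEquivOfEq _ _ hker ≪≫ₗ α.quotKerEquivOfSurjective hα
  refine ⟨e.toLinearMap ∘ₗ B.mkQ, e.surjective.comp B.mkQ_surjective, ?_, fun g => ?_⟩
  · rw [LinearEquiv.ker_comp, Submodule.ker_mkQ]
  · have h : ((B.mkQ ∘ₗ β).quotKerEquivOfSurjective hπ).symm (B.mkQ (β g)) =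
        Submodule.Quotient.mk g := by
      rw [LinearEquiv.symm_apply_eq]
      rfl
    change (α.quotKerEquivOfSurjective hα) (Submodule.quotEquivOfEq _ _ hker
      (((B.mkQ ∘ₗ β).quotKerEquivOfSurjective hπ).symm (B.mkQ (β g)))) = _
    rw [h]
    rfl

end Span

/-- A module that surjects onto the cycles in a given degree computes the homology there. -/
lemma exists_homologyIso {R : Type uR} [CommRing R] {κ : Type*} {c : ComplexShape κ}
    (K : HomologicalComplex (ModuleCat.{v} R) c) (i : κ) {S : Type*} [AddCommGroup S] [Module R S]
    (Y : ModuleCat.{v} R) (f : S →ₗ[R] K.X i) (ψ : S →ₗ[R] Y) (hψ : Function.Surjective ψ)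
    (hf : ∀ s j, K.d i j (f s) = 0) (hf' : ∀ x, (∀ j, K.d i j x = 0) → ∃ s, f s = x)
    (hk : ∀ s, ψ s = 0 ↔ ∃ j w, K.d j i w = f s) :
    ∃ e : K.homology i ≅ Y, ∀ s z, K.iCycles i z = f s → e.hom (K.homologyπ i z) = ψ s := by
  -- The lift of `f` to cycles is chosen pointwise; it is linear because `iCycles` is injective.
  let φ : S → K.cycles i := fun s => (exists_iCycles_eq K i (hf s)).choose
  have hφ : ∀ s, K.iCycles i (φ s) = f s := fun s => (exists_iCycles_eq K i (hf s)).choose_spec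
  have hinj := iCycles_injective_of_modules K i
  let φ' : S →ₗ[R] K.cycles i :=
    { toFun := φ
      map_add' := fun s t => hinj (by rw [map_add, hφ, hφ, hφ, map_add])
      map_smul' := fun r s => hinj (by rw [RingHom.id_apply, map_smul, hφ, hφ, map_smul]) }
  let g : S →ₗ[R] K.homology i := (K.homologyπ i).hom ∘ₗ φ'
  have hg : ∀ s z, K.iCycles i z = f s → g s = K.homologyπ i z := fun s z h => by
    rw [hinj (h.trans (hφ s).symm)]
    rfl
  have hgs : ∀ h, ∃ s, g s = h := by
    intro h
    obtain ⟨z, rfl⟩ := homologyπ_surjective_of_modules K i h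
    obtain ⟨s, hs⟩ := hf' (K.iCycles i z) fun j => d_iCycles_apply K i j z
    exact ⟨s, hg s z hs.symm⟩
  obtain ⟨θ, h1, h2, h3⟩ := exists_linearMap_of_correspondence ψ g ⊥ hψ
    (fun h => by
      obtain ⟨s, rfl⟩ := hgs h
      exact ⟨s, by simp⟩)
    (fun s => by
      rw [hk, Submodule.mem_bot, hg s _ (hφ s), homologyπ_eq_zero_iff, hφ])
  refine ⟨(LinearEquiv.ofBijective θ ⟨LinearMap.ker_eq_bot.1 h2, h1⟩).toModuleIso,
    fun s z h => ?_⟩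
  rw [← h3, hg s z h]
  rfl

/-! ### The spectral sequence of a filtered complex -/

namespace ChainFiltration

variable {R : Type uR} [CommRing R] {K : ChainComplex (ModuleCat.{v} R) ℕ} (F : ChainFiltration K)

lemma d_d_apply (i j k : ℕ) (x : K.X i) : K.d j k (K.d i j x) = 0 := by
  have := congrArg (fun f => f.hom x) (K.d_comp_d i j k)
  exact this

lemma d_eq_zero_of_ne {i j : ℕ} (h : j + 1 ≠ i) (x : K.X i) : K.d i j x = 0 := by
  rw [K.shape i j h]
  rfl

lemma sub_mono {p p' : ℤ} (h : p ≤ p') (n : ℕ) : F.sub p n ≤ F.sub p' n := by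
  induction p', h using Int.leInduction with
  | base => exact le_rfl
  | succ p' _ ih => exact ih.trans (F.mono p' n)

lemma d_mem {p : ℤ} {n : ℕ} {x : K.X n} (hx : x ∈ F.sub p n) (j : ℕ) : K.d n j x ∈ F.sub p j :=
  F.map_d p n j hx

lemma eq_zero_of_mem {p : ℤ} (hp : p < 0) {n : ℕ} {x : K.X n} (hx : x ∈ F.sub p n) : x = 0 := by
  rwa [F.eq_bot p hp, Submodule.mem_bot] at hx

lemma mem_Z {r p : ℤ} {n : ℕ} {x : K.X n} :
    x ∈ F.Z r p n ↔ x ∈ F.sub p n ∧ ∀ j, K.d n j x ∈ F.sub (p - r) j := by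
  simp only [Z, Submodule.mem_inf, Submodule.mem_iInf, Submodule.mem_comap]

lemma mem_Z_of_succ {r p : ℤ} {m n : ℕ} (h : n + 1 = m) {x : K.X m} (hx : x ∈ F.sub p m)
    (hd : K.d m n x ∈ F.sub (p - r) n) : x ∈ F.Z r p m := by
  refine F.mem_Z.2 ⟨hx, fun j => ?_⟩
  by_cases hj : j + 1 = m
  · obtain rfl : j = n := by omega
    exact hd
  · rw [d_eq_zero_of_ne hj]
    exact zero_mem _

lemma mem_B {r p : ℤ} {m n : ℕ} (h : n + 1 = m) {x : K.X n} :
    x ∈ F.B r p n ↔ ∃ u ∈ F.Z (r - 1) (p - 1) n, ∃ w ∈ F.Z (r - 1) (p + r - 1) m,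
      x = u + K.d m n w := by
  subst h
  simp only [B, Submodule.mem_sup, Submodule.mem_map]
  constructor
  · rintro ⟨u, hu, _, ⟨w, hw, rfl⟩, rfl⟩
    exact ⟨u, hu, w, hw, rfl⟩
  · rintro ⟨u, hu, w, hw, rfl⟩
    exact ⟨u, hu, _, ⟨w, hw, rfl⟩, rfl⟩

lemma d_mem_B {r p : ℤ} {m n : ℕ} {w : K.X m} (hw : w ∈ F.Z (r - 1) (p + r - 1) m) :
    K.d m n w ∈ F.B r p n := by
  by_cases h : n + 1 = m
  · exact (F.mem_B h).2 ⟨0, zero_mem _, w, hw, by simp⟩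
  · rw [d_eq_zero_of_ne h]
    exact zero_mem _

lemma mem_B_of_mem_Z {r p : ℤ} {n : ℕ} {u : K.X n} (hu : u ∈ F.Z (r - 1) (p - 1) n) :
    u ∈ F.B r p n :=
  (F.mem_B rfl).2 ⟨u, hu, 0, zero_mem _, by simp⟩

lemma d_mem_Z {r p p' : ℤ} (h : p - r = p') {n : ℕ} {x : K.X n} (hx : x ∈ F.Z r p n) (j : ℕ) :
    K.d n j x ∈ F.Z r p' j := by
  subst h
  refine F.mem_Z.2 ⟨(F.mem_Z.1 hx).2 j, fun k => ?_⟩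
  rw [d_d_apply]
  exact zero_mem _

lemma d_B_mem_B {r p p' : ℤ} (h : p - r = p') {n : ℕ} {x : K.X n} (hx : x ∈ F.B r p n) (j : ℕ) :
    K.d n j x ∈ F.B r p' j := by
  obtain ⟨u, hu, w, hw, rfl⟩ := (F.mem_B rfl).1 hx
  rw [map_add, d_d_apply, add_zero]
  refine F.d_mem_B ?_
  rwa [show p' + r - 1 = p - 1 by omega]

/-- The differential `Z^r_p → Z^r_(p-r)`. -/
def dZ {r p p' : ℤ} (h : p - r = p') (n n' : ℕ) : F.Z r p n →ₗ[R] F.Z r p' n' :=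
  (K.d n n').hom.restrict fun _ hx => F.d_mem_Z h hx n'

lemma coe_dZ {r p p' : ℤ} (h : p - r = p') (n n' : ℕ) (z : F.Z r p n) :
    (F.dZ h n n' z : K.X n') = K.d n n' (z : K.X n) := rfl

/-- The module `Z^r_p / B^r_p` in degree `n`. -/
abbrev PageX (r p : ℤ) (n : ℕ) : Type v := F.Z r p n ⧸ (F.B r p n).comap (F.Z r p n).subtype

/-- The projection `Z^r_p → Z^r_p / B^r_p`. -/
abbrev pageMk (r p : ℤ) (n : ℕ) : F.Z r p n →ₗ[R] F.PageX r p n :=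
  ((F.B r p n).comap (F.Z r p n).subtype).mkQ

lemma pageMk_eq_zero_iff {r p : ℤ} {n : ℕ} (z : F.Z r p n) :
    F.pageMk r p n z = 0 ↔ (z : K.X n) ∈ F.B r p n := by
  simp [pageMk]

/-- The differential of the `r`-th page. -/
def pageD {r p p' : ℤ} (h : p - r = p') (n n' : ℕ) : F.PageX r p n →ₗ[R] F.PageX r p' n' :=
  Submodule.mapQ _ _ (F.dZ h n n') fun _ hx => F.d_B_mem_B h hx n'

/-- The `r`-th page of the spectral sequence of a filtered complex. -/
def page (r : ℤ) : HomologicalComplex (ModuleCat.{v} R)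
    (ComplexShape.spectralSequenceNat ((-r, r - 1) : ℤ × ℤ)) where
  X pq := ModuleCat.of R (F.PageX r pq.1 (pq.1 + pq.2))
  d pq pq' := open Classical in
    if h : (pq.1 : ℤ) - r = pq'.1 ∧ (pq.2 : ℤ) + (r - 1) = pq'.2 then
      ModuleCat.ofHom (F.pageD h.1 (pq.1 + pq.2) (pq'.1 + pq'.2)) else 0
  shape pq pq' h := by
    rw [dif_neg]
    simpa [ComplexShape.spectralSequenceNat, sub_eq_add_neg] using h
  d_comp_d' pq pq' pq'' h h' := by
    simp only [ComplexShape.spectralSequenceNat] at h h'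
    rw [dif_pos ⟨by omega, by omega⟩, dif_pos ⟨by omega, by omega⟩]
    refine ModuleCat.hom_ext (Submodule.linearMap_qext _ (LinearMap.ext fun z => ?_))
    change F.pageMk r pq''.1 (pq''.1 + pq''.2) _ = 0
    rw [pageMk_eq_zero_iff]
    change K.d _ _ (K.d _ _ (z : K.X (pq.1 + pq.2))) ∈ _
    rw [d_d_apply]
    exact zero_mem _

/-- The projection of `Z^r_p` onto the `r`-th page. -/
def pageProj (r : ℤ) (p q : ℕ) : F.Z r p (p + q) →ₗ[R] (F.page r).X (p, q) :=
  F.pageMk r p (p + q)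

lemma pageProj_surjective (r : ℤ) (p q : ℕ) : Function.Surjective (F.pageProj r p q) :=
  Submodule.mkQ_surjective _

lemma ker_pageProj (r : ℤ) (p q : ℕ) :
    LinearMap.ker (F.pageProj r p q) = (F.B r p (p + q)).comap (F.Z r p (p + q)).subtype :=
  Submodule.ker_mkQ _

lemma pageProj_eq_zero_iff {r : ℤ} {p q : ℕ} (z : F.Z r p (p + q)) :
    F.pageProj r p q z = 0 ↔ (z : K.X (p + q)) ∈ F.B r p (p + q) := by
  rw [← LinearMap.mem_ker, ker_pageProj]
  rfl

lemma pageProj_eq_iff {r : ℤ} {p q : ℕ} (z z' : F.Z r p (p + q)) :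
    F.pageProj r p q z = F.pageProj r p q z' ↔ (z : K.X (p + q)) - z' ∈ F.B r p (p + q) := by
  rw [← sub_eq_zero, ← map_sub, pageProj_eq_zero_iff]
  rfl

lemma page_d_pageProj {r : ℤ} {p q p' q' : ℕ} (h : (p : ℤ) - r = p') (h' : (q : ℤ) + (r - 1) = q')
    (z : F.Z r p (p + q)) :
    (F.page r).d (p, q) (p', q') (F.pageProj r p q z) = F.pageProj r p' q' (F.dZ h _ _ z) := by
  have : (F.page r).d (p, q) (p', q') = ModuleCat.ofHom (F.pageD h (p + q) (p' + q')) :=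
    dif_pos ⟨h, h'⟩
  rw [this]
  rfl

/-- The degree `m` is kept free: a chain of degree `p + q + 1` has to be used at a position `(p',
q')` where `p' + q'` is only propositionally equal to it. -/
lemma exists_page_d_eq {r : ℤ} {p q p' q' m : ℕ} (h : (p : ℤ) - r = p')
    (h' : (q : ℤ) + (r - 1) = q') (hm : m = p + q) {w : K.X m} (hw : w ∈ F.Z r p m) :
    ∃ x, (F.page r).d (p, q) (p', q') x = F.pageProj r p' q' ⟨K.d m _ w, F.d_mem_Z h hw _⟩ := by
  subst hm
  exact ⟨_, F.page_d_pageProj h h' ⟨w, hw⟩⟩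

lemma page_d_eq_zero {r : ℤ} {p q p' q' : ℕ}
    (h : ¬ ((p : ℤ) - r = p' ∧ (q : ℤ) + (r - 1) = q')) : (F.page r).d (p, q) (p', q') = 0 :=
  dif_neg h

lemma page_d_apply_eq_zero {r : ℤ} {p q p' q' : ℕ}
    (h : ¬ ((p : ℤ) - r = p' ∧ (q : ℤ) + (r - 1) = q')) (x : (F.page r).X (p, q)) :
    (F.page r).d (p, q) (p', q') x = 0 := by
  rw [F.page_d_eq_zero h]
  exact LinearMap.zero_apply x

/-! ### From one page to the next -/

lemma Z_succ_le {r r' p : ℤ} (h : r + 1 = r') (n : ℕ) : F.Z r' p n ≤ F.Z r p n := fun _ hx =>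
  F.mem_Z.2 ⟨(F.mem_Z.1 hx).1, fun j => F.sub_mono (by omega) _ ((F.mem_Z.1 hx).2 j)⟩

/-- If the class of `z` is a cycle of the page, then `dz = u + dw` with `u` one step deeper in the
filtration and `w` in `F^(p-1)`. Subtracting `w` does not change the class, and `z - w` lies in
`Z^(r+1)_p`. -/
lemma exists_lift_of_page_cycle (hF : ∀ (p : ℤ) (n : ℕ), (n : ℤ) ≤ p → F.sub p n = ⊤) {r r' : ℤ}
    (hr' : r + 1 = r') {p q : ℕ} (z : F.Z r p (p + q))
    (hz : ∀ j, (F.page r).d (p, q) j (F.pageProj r p q z) = 0) :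
    ∃ s : F.Z r' p (p + q), F.pageProj r p q (Submodule.inclusion (F.Z_succ_le hr' _) s) =
      F.pageProj r p q z := by
  have hz' := F.mem_Z.1 z.2
  suffices h : ∃ w ∈ F.sub (p - 1) (p + q),
      ∀ j, K.d (p + q) j ((z : K.X (p + q)) - w) ∈ F.sub (p - r') j by
    obtain ⟨w, hw, hd⟩ := h
    refine ⟨⟨z - w, F.mem_Z.2 ⟨sub_mem hz'.1 (F.sub_mono (by omega) _ hw), hd⟩⟩, ?_⟩
    rw [pageProj_eq_iff]
    refine F.mem_B_of_mem_Z ?_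
    change (z : K.X (p + q)) - w - z ∈ _
    rw [sub_sub_cancel_left]
    refine neg_mem (F.mem_Z.2 ⟨hw, fun j => ?_⟩)
    have := sub_mem (hz'.2 j) (F.sub_mono (by omega : (p : ℤ) - r' ≤ p - r) _ (hd j))
    rw [map_sub, sub_sub_cancel] at this
    exact F.sub_mono (by omega) _ this
  -- The differential would leave the quadrant on the left: then `dz` lies in `F^(p-r) = 0`.
  by_cases hp : (p : ℤ) < r
  · refine ⟨0, zero_mem _, fun j => ?_⟩
    rw [sub_zero, F.eq_zero_of_mem (by omega) (hz'.2 j)]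
    exact zero_mem _
  -- The target would lie below the quadrant: then `p + q - 1 ≤ p - r'`, so `F^(p-r')` is everything
  -- in the degree of `dz`.
  by_cases hq : (q : ℤ) + (r - 1) < 0
  · refine ⟨0, zero_mem _, fun j => ?_⟩
    by_cases hj : j + 1 = p + q
    · rw [hF _ _ (by omega)]
      trivial
    · rw [d_eq_zero_of_ne hj]
      exact zero_mem _
  · obtain ⟨p', hp'⟩ : ∃ p' : ℕ, (p : ℤ) - r = p' := ⟨(p - r).toNat, by omega⟩
    obtain ⟨q', hq'⟩ : ∃ q' : ℕ, (q : ℤ) + (r - 1) = q' := ⟨(q + (r - 1)).toNat, by omega⟩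
    have h := hz (p', q')
    rw [F.page_d_pageProj hp' hq', pageProj_eq_zero_iff, coe_dZ,
      F.mem_B (by omega : p' + q' + 1 = p + q)] at h
    obtain ⟨u, hu, w, hw, e⟩ := h
    rw [mem_Z] at hu hw
    refine ⟨w, F.sub_mono (by omega) _ hw.1, fun j => ?_⟩
    by_cases hj : j + 1 = p + q
    · obtain rfl : j = p' + q' := by omega
      rw [map_sub, e, add_sub_cancel_right]
      exact F.sub_mono (by omega) _ hu.1
    · rw [d_eq_zero_of_ne hj]
      exact zero_mem _

/-- For `s` in `Z^(r+1)_p` the chain `ds` is a cycle in `F^(p-r-1)`, which is part of `B^r_(p-r)`.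
-/
lemma page_d_pageProj_inclusion {r r' : ℤ} (hr' : r + 1 = r') {p q : ℕ} (s : F.Z r' p (p + q))
    (j : ℕ × ℕ) : (F.page r).d (p, q) j
      (F.pageProj r p q (Submodule.inclusion (F.Z_succ_le hr' _) s)) = 0 := by
  obtain ⟨p', q'⟩ := j
  by_cases h : (p : ℤ) - r = p' ∧ (q : ℤ) + (r - 1) = q'
  · rw [F.page_d_pageProj h.1 h.2]
    rw [pageProj_eq_zero_iff, coe_dZ, Submodule.coe_inclusion]
    refine F.mem_B_of_mem_Z (F.mem_Z.2 ⟨?_, fun j => ?_⟩)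
    · exact F.sub_mono (by omega) _ ((F.mem_Z.1 s.2).2 _)
    · rw [d_d_apply]
      exact zero_mem _
  · exact F.page_d_apply_eq_zero h _

/-- An element of `Z^(r+1)_p` lies in `B^(r+1)_p` if it is a boundary of the `r`-th page. -/
lemma mem_B_succ {r r' : ℤ} (hr' : r + 1 = r') {p : ℤ} {m n : ℕ} (hn : n + 1 = m) {s : K.X n}
    (hs : s ∈ F.Z r' p n) {w : K.X m} (hw : w ∈ F.Z r (p + r) m)
    (h : s - K.d m n w ∈ F.B r p n) : s ∈ F.B r' p n := by
  rw [F.mem_B hn] at h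
  obtain ⟨u, hu, v, hv, e⟩ := h
  have hs' := F.mem_Z.1 hs
  have hu' := F.mem_Z.1 hu
  have hv' := F.mem_Z.1 hv
  have hw' := F.mem_Z.1 hw
  have e' : s = u + K.d m n (w + v) := by
    rw [map_add, add_comm (K.d m n w), ← add_assoc, ← e, sub_add_cancel]
  subst hr'
  refine (F.mem_B hn).2 ⟨u, F.mem_Z.2 ⟨hu'.1, fun j => ?_⟩, w + v, F.mem_Z.2 ⟨?_, fun j => ?_⟩, e'⟩
  -- Since `s - u` is a boundary, `u` inherits from `s` the sharper bound on its differential.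
  · have : K.d n j u = K.d n j s := by rw [e', map_add, d_d_apply, add_zero]
    rw [this]
    exact F.sub_mono (by omega) _ (hs'.2 j)
  · exact add_mem (F.sub_mono (by omega) _ hw'.1) (F.sub_mono (by omega) _ hv'.1)
  · rw [map_add]
    exact add_mem (F.sub_mono (by omega) _ (hw'.2 j)) (F.sub_mono (by omega) _ (hv'.2 j))

lemma pageProj_succ_eq_zero_iff (hF : ∀ (p : ℤ) (n : ℕ), (n : ℤ) ≤ p → F.sub p n = ⊤) {r r' : ℤ}
    (hr' : r + 1 = r') (hr : 0 ≤ r) {p q : ℕ} (s : F.Z r' p (p + q)) :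
    F.pageProj r' p q s = 0 ↔ ∃ j w, (F.page r).d j (p, q) w =
      (F.pageProj r p q ∘ₗ Submodule.inclusion (F.Z_succ_le hr' _)) s := by
  rw [pageProj_eq_zero_iff]
  constructor
  · intro h
    obtain ⟨u, hu, w, hw, e⟩ := (F.mem_B rfl).1 h
    have hu' := F.mem_Z.1 hu
    have hw' := F.mem_Z.1 hw
    have hu'' : u ∈ F.B r p (p + q) :=
      F.mem_B_of_mem_Z (F.mem_Z.2 ⟨hu'.1, fun j => F.sub_mono (by omega) _ (hu'.2 j)⟩)
    -- No position of the quadrant has a differential into `(p, q)`. In exchange `F^(p+r-1)` is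
    -- everything in degree `p + q + 1`, so `dw` already lies in `B^r_p` and the class of `s` is
    -- zero.
    by_cases hq : (q : ℤ) + 1 < r
    · refine ⟨(p, q), 0, ?_⟩
      rw [map_zero, eq_comm]
      rw [LinearMap.comp_apply, pageProj_eq_zero_iff, Submodule.coe_inclusion, e]
      refine add_mem hu'' (F.d_mem_B (F.mem_Z.2 ⟨?_, fun j => F.sub_mono (by omega) _ (hw'.2 j)⟩))
      rw [hF _ _ (by push_cast; omega)]
      trivial
    · obtain ⟨p', hp'⟩ : ∃ p' : ℕ, (p : ℤ) + r = p' := ⟨(p + r).toNat, by omega⟩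
      obtain ⟨q', hq'⟩ : ∃ q' : ℕ, (q : ℤ) - (r - 1) = q' := ⟨(q - (r - 1)).toNat, by omega⟩
      obtain ⟨x, hx⟩ := F.exists_page_d_eq (r := r) (p := p') (q := q') (p' := p) (q' := q)
        (by omega) (by omega) (by omega : p + q + 1 = p' + q')
        (show w ∈ F.Z r p' _ by
          rw [← hp']
          convert hw using 2 <;> omega)
      refine ⟨(p', q'), x, ?_⟩
      rw [hx, LinearMap.comp_apply, pageProj_eq_iff, Submodule.coe_inclusion, e, sub_add_cancel_right]
      exact neg_mem hu''
  · rintro ⟨⟨p', q'⟩, x, hx⟩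
    by_cases h : (p' : ℤ) - r = p ∧ (q' : ℤ) + (r - 1) = q
    · obtain ⟨w, rfl⟩ := F.pageProj_surjective r p' q' x
      rw [F.page_d_pageProj h.1 h.2, LinearMap.comp_apply, eq_comm, pageProj_eq_iff, coe_dZ,
        Submodule.coe_inclusion] at hx
      refine F.mem_B_succ hr' (by omega : p + q + 1 = p' + q') s.2 (w := w) ?_ hx
      rw [show (p : ℤ) + r = p' by omega]
      exact w.2
    · rw [F.page_d_apply_eq_zero h, LinearMap.comp_apply, eq_comm, pageProj_eq_zero_iff,
        Submodule.coe_inclusion] at hx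
      refine F.mem_B_succ hr' rfl s.2 (w := 0) (zero_mem _) ?_
      rwa [map_zero, sub_zero]

lemma exists_pageIso (hF : ∀ (p : ℤ) (n : ℕ), (n : ℤ) ≤ p → F.sub p n = ⊤) {r r' : ℤ}
    (hr' : r + 1 = r') (hr : 0 ≤ r) (p q : ℕ) :
    ∃ e : (F.page r).homology (p, q) ≅ (F.page r').X (p, q),
      ∀ (z : F.Z r' p (p + q)) (c : (F.page r).cycles (p, q)),
        (F.page r).iCycles (p, q) c =
          F.pageProj r p q (Submodule.inclusion (F.Z_succ_le hr' _) z) →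
        e.hom ((F.page r).homologyπ (p, q) c) = F.pageProj r' p q z := by
  refine exists_homologyIso (F.page r) (p, q) ((F.page r').X (p, q))
    (F.pageProj r p q ∘ₗ Submodule.inclusion (F.Z_succ_le hr' _)) (F.pageProj r' p q)
    (F.pageProj_surjective _ _ _) (F.page_d_pageProj_inclusion hr') ?_ ?_
  · intro x hx
    obtain ⟨z, rfl⟩ := F.pageProj_surjective r p q x
    exact F.exists_lift_of_page_cycle hF hr' z hx
  · exact F.pageProj_succ_eq_zero_iff hF hr' hr

/-- The spectral sequence of a filtered complex with `F^p K_n = K_n` for `n ≤ p`. -/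
def spectralSequence (hF : ∀ (p : ℤ) (n : ℕ), (n : ℤ) ≤ p → F.sub p n = ⊤) :
    FirstQuadrantSpectralSequence.{uR, v} R where
  page r _ := F.page r
  iso _ _ pq h hr := (F.exists_pageIso hF h hr pq.1 pq.2).choose

/-- The pages of `spectralSequence` are the modules `Z^r_p / B^r_p`. -/
def isSpectralSequence (hF : ∀ (p : ℤ) (n : ℕ), (n : ℤ) ≤ p → F.sub p n = ⊤) :
    F.IsSpectralSequence (F.spectralSequence hF) where
  proj r _ p q := F.pageProj r p q
  proj_surjective r _ p q := F.pageProj_surjective r p q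
  ker_proj r _ p q := F.ker_pageProj r p q
  d_proj r hr p q p' q' h h' z z' hz := by
    have e : F.dZ h (p + q) (p' + q') z = z' := Subtype.ext (by rw [hz, coe_dZ])
    rw [← e]
    exact F.page_d_pageProj h h' z
  iso_proj r hr p q z z' hz c hc := by
    have e : Submodule.inclusion (F.Z_succ_le rfl _) z = z' :=
      Subtype.ext (by rw [hz, Submodule.coe_inclusion])
    rw [← e] at hc
    exact (F.exists_pageIso hF rfl hr p q).choose_spec z c hc

/-! ### Convergence and comparison with the second page -/

lemma homologyFiltration_eq_top {p : ℤ} {n : ℕ} (h : F.sub p n = ⊤) :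
    F.homologyFiltration p n = ⊤ := by
  rw [homologyFiltration, h, Submodule.comap_top, Submodule.map_top, LinearMap.range_eq_top]
  exact homologyπ_surjective_of_modules K n

lemma mem_homologyFiltration {p : ℤ} {n : ℕ} {x : K.homology n} :
    x ∈ F.homologyFiltration p n ↔ ∃ c, K.iCycles n c ∈ F.sub p n ∧ K.homologyπ n c = x := Iff.rfl

/-- The classes of cycles in `F^p` on a late page are the classes in `F^p H / F^(p-1) H`. -/
lemma exists_limitPageEquiv (hF : ∀ (p : ℤ) (n : ℕ), (n : ℤ) ≤ p → F.sub p n = ⊤) (p q : ℕ) (r : ℤ)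
    (hr : (p : ℤ) + q + 1 < r) :
    ∃ e : (F.page r).X (p, q) ≃ₗ[R] F.grHomology p (p + q),
      ∀ (z : F.Z r p (p + q)) (c : K.cycles (p + q)) (w : F.homologyFiltration p (p + q)),
        K.iCycles (p + q) c = (z : K.X (p + q)) →
        (w : K.homology (p + q)) = K.homologyπ (p + q) c →
        e (F.pageProj r p q z) = Submodule.Quotient.mk w := by
  let T : Submodule R (K.cycles (p + q)) := (F.sub p (p + q)).comap (K.iCycles (p + q)).hom
  let toZ : T →ₗ[R] F.Z r p (p + q) := LinearMap.codRestrict _ ((K.iCycles (p + q)).hom ∘ₗ T.subtype)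
    fun t => F.mem_Z.2 ⟨t.2, fun j => by
      have := d_iCycles_apply K (p + q) j t.1
      change K.d (p + q) j (K.iCycles (p + q) t.1) ∈ _
      rw [this]
      exact zero_mem _⟩
  have coe_toZ : ∀ t, (toZ t : K.X (p + q)) = K.iCycles (p + q) t.1 := fun _ => rfl
  let toH : T →ₗ[R] F.homologyFiltration p (p + q) :=
    LinearMap.codRestrict _ ((K.homologyπ (p + q)).hom ∘ₗ T.subtype) fun t => ⟨t.1, t.2, rfl⟩
  have coe_toH : ∀ t, (toH t : K.homology (p + q)) = K.homologyπ (p + q) t.1 := fun _ => rfl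
  let mkH : F.homologyFiltration p (p + q) →ₗ[R] F.grHomology p (p + q) := Submodule.mkQ _
  have mkH_eq_zero : ∀ w, mkH w = 0 ↔ (w : K.homology (p + q)) ∈ F.homologyFiltration (p - 1) _ :=
    fun w => (Submodule.Quotient.mk_eq_zero _).trans Iff.rfl
  have hcycle : ∀ z : F.Z r p (p + q), ∃ t, toZ t = z := by
    intro z
    have hz := F.mem_Z.1 z.2
    -- As `p < r`, the differential of `z` lies in `F^(p-r) = 0`, so on late pages `Z^r_p` consists
    -- of honest cycles.
    obtain ⟨c, hc⟩ := exists_iCycles_eq K (p + q) (x := (z : K.X (p + q)))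
      fun j => F.eq_zero_of_mem (by omega) (hz.2 j)
    have hcF : c ∈ T := by
      change K.iCycles (p + q) c ∈ F.sub p (p + q)
      rw [hc]
      exact hz.1
    exact ⟨⟨c, hcF⟩, Subtype.ext ((coe_toZ _).trans hc)⟩
  obtain ⟨θ, h1, h2, h3⟩ := exists_linearMap_of_correspondence (mkH ∘ₗ toH)
    (F.pageProj r p q ∘ₗ toZ) ⊥ (by
      refine (Submodule.mkQ_surjective _).comp ?_
      rintro ⟨_, c, hc, rfl⟩
      exact ⟨⟨c, hc⟩, rfl⟩) (fun x => by
      obtain ⟨z, rfl⟩ := F.pageProj_surjective r p q x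
      obtain ⟨t, rfl⟩ := hcycle z
      exact ⟨t, by simp⟩) (fun t => by
      rw [LinearMap.comp_apply, mkH_eq_zero, Submodule.mem_bot, LinearMap.comp_apply,
        pageProj_eq_zero_iff, coe_toH, coe_toZ, mem_homologyFiltration, F.mem_B rfl]
      constructor
      · rintro ⟨c, hc, e⟩
        have e' : K.homologyπ (p + q) (t.1 - c) = 0 := by rw [map_sub, e, sub_self]
        obtain ⟨j, w, hw⟩ := (homologyπ_eq_zero_iff K _ _).1 e'
        rw [map_sub] at hw
        have hc' : K.iCycles (p + q) c ∈ F.Z (r - 1) (p - 1) (p + q) :=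
          F.mem_Z.2 ⟨hc, fun j => by rw [d_iCycles_apply]; exact zero_mem _⟩
        by_cases hj : p + q + 1 = j
        · subst hj
          refine ⟨_, hc', w, F.mem_Z.2 ⟨?_, fun j => ?_⟩, ?_⟩
          · rw [hF _ _ (by push_cast; omega)]
            trivial
          · by_cases hj : j + 1 = p + q + 1
            · obtain rfl : j = p + q := by omega
              rw [hw]
              exact sub_mem (F.sub_mono (by omega) _ t.2) (F.sub_mono (by omega) _ hc)
            · rw [d_eq_zero_of_ne hj]
              exact zero_mem _
          · rw [hw, add_sub_cancel]
        · rw [d_eq_zero_of_ne hj, eq_comm, sub_eq_zero] at hw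
          exact ⟨_, hc', 0, zero_mem _, by rw [hw, map_zero, add_zero]⟩
      · rintro ⟨u, hu, w, hw, e⟩
        obtain ⟨c, hc⟩ := exists_iCycles_eq K (p + q) (x := u)
          fun j => F.eq_zero_of_mem (by omega) ((F.mem_Z.1 hu).2 j)
        refine ⟨c, hc ▸ (F.mem_Z.1 hu).1, ?_⟩
        rw [eq_comm, ← sub_eq_zero, ← map_sub, homologyπ_eq_zero_iff]
        exact ⟨_, w, by rw [map_sub, hc, e, add_sub_cancel_left]⟩)
  refine ⟨LinearEquiv.ofBijective θ ⟨LinearMap.ker_eq_bot.1 h2, h1⟩, fun z c w hc hw => ?_⟩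
  have hcT : c ∈ T := by
    change K.iCycles (p + q) c ∈ F.sub p (p + q)
    rw [hc]
    exact (F.mem_Z.1 z.2).1
  have ez : toZ ⟨c, hcT⟩ = z := Subtype.ext ((coe_toZ _).trans hc)
  have ew : toH ⟨c, hcT⟩ = w := Subtype.ext ((coe_toH _).trans hw.symm)
  rw [← ez, ← ew]
  exact h3 ⟨c, hcT⟩

lemma convergesToHomology (hF : ∀ (p : ℤ) (n : ℕ), (n : ℤ) ≤ p → F.sub p n = ⊤) :
    F.ConvergesToHomology (F.isSpectralSequence hF) := by
  refine ⟨fun n => ⟨n, F.homologyFiltration_eq_top (hF n n le_rfl)⟩, fun p q r hr =>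
    ⟨fun pq' => ⟨F.page_d_eq_zero (by omega), F.page_d_eq_zero (by omega)⟩,
      F.exists_limitPageEquiv hF p q r hr⟩⟩

/-- A chain complex onto which the modules `Z^1_p` of the `q`-th row map with kernels `B^1_p`,
compatibly with the differentials up to a sign, computes the `q`-th row of the second page. -/
lemma nonempty_secondPageIso (hF : ∀ (p : ℤ) (n : ℕ), (n : ℤ) ≤ p → F.sub p n = ⊤) (q : ℕ)
    (L : ChainComplex (ModuleCat.{v} R) ℕ) (ε : R) (hε : ε * ε = 1)
    (θ : ∀ p : ℕ, F.Z 1 p (p + q) →ₗ[R] L.X p) (hθ : ∀ p, Function.Surjective (θ p))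
    (hker : ∀ p z, θ p z = 0 ↔ (z : K.X (p + q)) ∈ F.B 1 p (p + q))
    (hd : ∀ (p : ℕ) (h : ((p + 1 : ℕ) : ℤ) - 1 = p) (z : F.Z 1 (p + 1 : ℕ) (p + 1 + q)),
      L.d (p + 1) p (θ (p + 1) z) = ε • θ p (F.dZ h _ _ z)) (p : ℕ) :
    Nonempty ((F.page 2).X (p, q) ≅ L.homology p) := by
  have hθ' : ∀ p z, θ p z = 0 ↔ F.pageProj 1 p q z = 0 := fun p z => by
    rw [hker, pageProj_eq_zero_iff]
  have heq : ∀ p z z', θ p z = θ p z' ↔ F.pageProj 1 p q z = F.pageProj 1 p q z' :=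
    fun p z z' => by rw [← sub_eq_zero, ← map_sub, hθ', map_sub, sub_eq_zero]
  have hε' : ∀ {p : ℕ} (x : L.X p), ε • x = 0 ↔ x = 0 := fun x =>
    ⟨fun h => by rw [← one_smul R x, ← hε, mul_smul, h, smul_zero], fun h => by rw [h, smul_zero]⟩
  obtain ⟨e, -⟩ := exists_homologyIso L p ((F.page 2).X (p, q))
    (θ p ∘ₗ Submodule.inclusion (F.Z_succ_le (by norm_num) _)) (F.pageProj 2 p q)
    (F.pageProj_surjective _ _ _) (fun s j => by
      by_cases hj : j + 1 = p
      · subst hj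
        rw [LinearMap.comp_apply, hd j (by simp), hε', hθ',
          ← F.page_d_pageProj (by simp) (by simp)]
        exact F.page_d_pageProj_inclusion (by norm_num) s _
      · exact d_eq_zero_of_ne hj _) (fun x hx => by
      obtain ⟨z, rfl⟩ := hθ p x
      obtain ⟨s, hs⟩ := F.exists_lift_of_page_cycle hF (by norm_num : (1 : ℤ) + 1 = 2) z (by
        rintro ⟨p', q'⟩
        by_cases h : (p : ℤ) - 1 = p' ∧ (q : ℤ) + (1 - 1) = q'
        · obtain rfl : p = p' + 1 := by omega
          obtain rfl : q = q' := by omega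
          rw [F.page_d_pageProj h.1 h.2, ← hθ', ← hε', ← hd]
          exact hx p'
        · exact F.page_d_apply_eq_zero h _)
      exact ⟨s, (heq _ _ _).2 hs⟩) (fun s => by
      rw [F.pageProj_succ_eq_zero_iff hF (by norm_num : (1 : ℤ) + 1 = 2) (by norm_num)]
      constructor
      · rintro ⟨⟨p', q'⟩, w, hw⟩
        by_cases h : (p' : ℤ) - 1 = p ∧ (q' : ℤ) + (1 - 1) = q
        · obtain rfl : p' = p + 1 := by omega
          obtain rfl : q = q' := by omega
          obtain ⟨z, rfl⟩ := F.pageProj_surjective _ _ _ w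
          rw [F.page_d_pageProj h.1 h.2, LinearMap.comp_apply, ← heq] at hw
          -- The factor `ε` is its own inverse and absorbs the sign in `hd`.
          refine ⟨p + 1, ε • θ (p + 1) z, ?_⟩
          rw [map_smul, hd _ h.1, smul_smul, hε, one_smul, hw, LinearMap.comp_apply]
        · rw [F.page_d_apply_eq_zero h, LinearMap.comp_apply, eq_comm, ← hθ'] at hw
          exact ⟨p, 0, by rw [map_zero, LinearMap.comp_apply, hw]⟩
      · rintro ⟨p', w, hw⟩
        by_cases h : p + 1 = p'
        · subst h
          obtain ⟨z, rfl⟩ := hθ _ w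
          refine ⟨(p + 1, q), ε • F.pageProj 1 (p + 1 : ℕ) q z, ?_⟩
          rw [hd _ (by simp), ← map_smul, LinearMap.comp_apply, heq] at hw
          rw [map_smul, F.page_d_pageProj (by simp) (by simp), ← map_smul, hw,
            LinearMap.comp_apply]
        · rw [d_eq_zero_of_ne h, LinearMap.comp_apply, eq_comm, hθ'] at hw
          exact ⟨(p, q), 0, by rw [map_zero, LinearMap.comp_apply, hw]⟩)
  exact ⟨e.symm⟩

end ChainFiltration

/-! ### Sequences with a repetition at a given position -/

section DupCat

variable {X : Type uX} {p s N : ℕ}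

/-- The sequence `(u_{s-1}, …, u_0, y_p, y_p, …, y_0)`. -/
def dupCat (_hN : N = p + 2 + s) (y : Fin (p + 1) → X) (u : Fin s → X) : Fin N → X := fun t =>
  if h : (t : ℕ) < p + 1 then y ⟨t, h⟩
  else if (t : ℕ) = p + 1 then y (Fin.last p)
  -- The final default is never reached, because `t < N = p + 2 + s`.
  else if h : (t : ℕ) - (p + 2) < s then u ⟨t - (p + 2), h⟩ else y (Fin.last p)

lemma dupCat_of_lt (hN : N = p + 2 + s) (y : Fin (p + 1) → X) (u : Fin s → X) {t : Fin N}
    (i : Fin (p + 1)) (h : (t : ℕ) = i) : dupCat hN y u t = y i := by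
  have h1 : (t : ℕ) < p + 1 := by omega
  rw [dupCat, dif_pos h1]
  congr 1
  exact Fin.ext h

lemma dupCat_of_eq (hN : N = p + 2 + s) (y : Fin (p + 1) → X) (u : Fin s → X) {t : Fin N}
    (h : (t : ℕ) = p + 1) : dupCat hN y u t = y (Fin.last p) := by
  rw [dupCat, dif_neg (by omega), if_pos h]

lemma dupCat_of_gt (hN : N = p + 2 + s) (y : Fin (p + 1) → X) (u : Fin s → X) {t : Fin N}
    (j : Fin s) (h : (t : ℕ) = p + 2 + j) : dupCat hN y u t = u j := by
  rw [dupCat, dif_neg (by omega), if_neg (by omega), dif_pos (by omega)]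
  congr 1
  exact Fin.ext (by simp only; omega)

/-- Case distinction on the positions of `dupCat`. -/
lemma dupCat_cases (hN : N = p + 2 + s) (t : Fin N) :
    (∃ i : Fin (p + 1), (t : ℕ) = i) ∨ (t : ℕ) = p + 1 ∨ ∃ j : Fin s, (t : ℕ) = p + 2 + j := by
  rcases lt_trichotomy (t : ℕ) (p + 1) with h | h | h
  · exact Or.inl ⟨⟨t, h⟩, rfl⟩
  · exact Or.inr (Or.inl h)
  · exact Or.inr (Or.inr ⟨⟨t - (p + 2), by omega⟩, by simp only; omega⟩)

lemma dupCat_inj (hN : N = p + 2 + s) {y y' : Fin (p + 1) → X} {u u' : Fin s → X}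
    (h : dupCat hN y u = dupCat hN y' u') : y = y' ∧ u = u' := by
  constructor
  · funext i
    have := congrFun h ⟨i, by omega⟩
    rwa [dupCat_of_lt hN y u i rfl, dupCat_of_lt hN y' u' i rfl] at this
  · funext j
    have := congrFun h ⟨p + 2 + j, by omega⟩
    rwa [dupCat_of_gt hN y u j rfl, dupCat_of_gt hN y' u' j rfl] at this

lemma dupCat_injective (hN : N = p + 2 + s) (y : Fin (p + 1) → X) :
    Function.Injective (dupCat hN y) := fun _ _ h => (dupCat_inj hN h).2

lemma exists_dupCat_eq (hN : N = p + 2 + s) (x : Fin N → X)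
    (h : x ⟨p, by omega⟩ = x ⟨p + 1, by omega⟩) : ∃ y u, dupCat hN y u = x := by
  refine ⟨fun i => x ⟨i, by omega⟩, fun j => x ⟨p + 2 + j, by omega⟩, ?_⟩
  funext t
  rcases dupCat_cases hN t with ⟨i, hi⟩ | ht | ⟨j, hj⟩
  · rw [dupCat_of_lt hN _ _ i hi]
    congr 1
    exact Fin.ext hi.symm
  · rw [dupCat_of_eq hN _ _ ht]
    refine h.trans ?_
    congr 1
    exact Fin.ext ht.symm
  · rw [dupCat_of_gt hN _ _ j hj]
    congr 1
    exact Fin.ext hj.symm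

lemma hasRepetitionUpTo_dupCat (hN : N = p + 2 + s) (y : Fin (p + 1) → X) (u : Fin s → X) :
    HasRepetitionUpTo (p : ℤ) (dupCat hN y u) :=
  ⟨p, le_rfl, by omega, by
    rw [dupCat_of_lt hN y u (Fin.last p) rfl, dupCat_of_eq hN y u rfl]⟩

/-- A repetition at a position below `p` involves only entries with index at most `p`, and these are
the entries of `y`. -/
lemma hasRepetitionUpTo_dupCat_iff (hN : N = p + 2 + s) (y : Fin (p + 1) → X) (u : Fin s → X) :
    HasRepetitionUpTo ((p : ℤ) - 1) (dupCat hN y u) ↔ HasRepetition y := by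
  constructor
  · rintro ⟨i, hi, h, e⟩
    refine ⟨i, by omega, ?_⟩
    rwa [dupCat_of_lt hN y u ⟨i, by omega⟩ rfl, dupCat_of_lt hN y u ⟨i + 1, by omega⟩ rfl] at e
  · rintro ⟨i, h, e⟩
    refine ⟨i, by omega, by omega, ?_⟩
    rwa [dupCat_of_lt hN y u ⟨i, by omega⟩ rfl, dupCat_of_lt hN y u ⟨i + 1, by omega⟩ rfl]

lemma hasRepetitionUpTo_cases (hN : N = p + 2 + s) {x : Fin N → X}
    (h : HasRepetitionUpTo (p : ℤ) x) :
    HasRepetitionUpTo ((p : ℤ) - 1) x ∨ ∃ y u, dupCat hN y u = x := by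
  obtain ⟨i, hi, h, e⟩ := h
  rcases lt_or_eq_of_le (by omega : i ≤ p) with hip | rfl
  · exact Or.inl ⟨i, by omega, h, e⟩
  · exact Or.inr (exists_dupCat_eq hN x e)

variable {ι : Type uI} [Multispindle ι X]

lemma seqFace_dupCat_upper (k : ι) (hN : N = p + 2 + s) (hN' : N + 1 = p + 2 + (s + 1))
    (y : Fin (p + 1) → X) (u : Fin (s + 1) → X) (j : Fin (s + 1)) :
    seqFace k ⟨p + 2 + j, by omega⟩ (dupCat hN' y u) = dupCat hN y (seqFace k j u) := by
  funext t
  rcases dupCat_cases hN t with ⟨i, hi⟩ | ht | ⟨j', hj'⟩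
  · rw [seqFace_of_lt k _ _ t (by simp only; omega), dupCat_of_lt hN y _ i hi,
      dupCat_of_lt hN' y u i hi]
  · rw [seqFace_of_lt k _ _ t (by simp only; omega), dupCat_of_eq hN y _ ht,
      dupCat_of_eq hN' y u ht]
  · rw [dupCat_of_gt hN y _ j' hj']
    rcases lt_or_ge (j' : ℕ) j with h | h
    · rw [seqFace_of_lt k _ _ t (by simp only; omega), seqFace_of_lt k _ _ j' h,
        dupCat_of_gt hN' y u j'.castSucc (by simpa using hj')]
    · rw [seqFace_of_le k _ _ t (by simp only; omega), seqFace_of_le k _ _ j' h,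
        dupCat_of_gt hN' y u j'.succ (by simp; omega), dupCat_of_gt hN' y u j rfl]

/-- The face at `y_i` acts on every entry to its left, hence equally on both copies of the last
entry of `y` and on all of `u`; deleting `y_i` shifts the repetition one step to the right. -/
lemma seqFace_dupCat_lower (k : ι) (hN : N = p + 2 + s) (hN' : N + 1 = p + 1 + 2 + s)
    (y : Fin (p + 2) → X) (u : Fin s → X) (i : Fin (p + 1)) :
    seqFace k ⟨i, by omega⟩ (dupCat hN' y u) =
      dupCat hN (seqFace k i.castSucc y) (fun j => Multispindle.op k (u j) (y i.castSucc)) := by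
  have hi : dupCat hN' y u ⟨i, by omega⟩ = y i.castSucc := dupCat_of_lt hN' y u i.castSucc rfl
  funext t
  rcases dupCat_cases hN t with ⟨i', hi'⟩ | ht | ⟨j, hj⟩
  · rw [dupCat_of_lt hN _ _ i' hi']
    rcases lt_or_ge (i' : ℕ) i with h | h
    · rw [seqFace_of_lt k _ _ t (by simp only; omega), seqFace_of_lt k _ _ i' (by simpa using h),
        dupCat_of_lt hN' y u i'.castSucc (by simpa using hi')]
    · rw [seqFace_of_le k _ _ t (by simp only; omega), seqFace_of_le k _ _ i' (by simpa using h),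
        dupCat_of_lt hN' y u i'.succ (by simpa using hi'), hi]
  · rw [dupCat_of_eq hN _ _ ht, seqFace_of_le k _ _ t (by simp only; omega),
      seqFace_of_le k _ _ (Fin.last p) (by simp only [Fin.val_castSucc, Fin.val_last]; omega),
      dupCat_of_eq hN' y u (by simp; omega), hi]
    rfl
  · rw [dupCat_of_gt hN _ _ j hj, seqFace_of_le k _ _ t (by simp only; omega),
      dupCat_of_gt hN' y u j (by simp; omega), hi]

lemma seqFace_cons_zero (k : ι) {n : ℕ} (y : X) (u : Fin n → X) :
    seqFace k 0 (Fin.cons y u : Fin (n + 1) → X) = fun j => Multispindle.op k (u j) y := by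
  funext t
  rw [seqFace_of_le k _ _ t (by simp)]
  simp

lemma seqFace_cons_succ (k : ι) {n : ℕ} (y : X) (u : Fin (n + 1) → X) (i : Fin (n + 1)) :
    seqFace k i.succ (Fin.cons y u : Fin (n + 2) → X) =
      (Fin.cons y (seqFace k i u) : Fin (n + 1) → X) := by
  funext t
  refine Fin.cases ?_ (fun t => ?_) t
  · rw [seqFace_of_lt k _ _ 0 (by simp)]
    simp
  · rw [Fin.cons_succ]
    rcases lt_or_ge (t : ℕ) i with h | h
    · rw [seqFace_of_lt k _ _ _ (by simpa using h), seqFace_of_lt k _ _ _ h, ← Fin.succ_castSucc,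
        Fin.cons_succ]
    · rw [seqFace_of_le k _ _ _ (by simpa using h), seqFace_of_le k _ _ _ h,
        Fin.cons_succ, Fin.cons_succ]

end DupCat

/-- Used for the faces of `(u, y_p, y_p, …, y_0)`: `p` faces below the repetition, two at it, and
`s` above it. -/
lemma sum_fin_eq_lower_add_upper {V : Type*} [AddCommGroup V] {p s N : ℕ} (hN : N + 1 = p + 2 + s)
    (g : Fin (N + 1) → V) :
    ∑ i, g i = ((∑ i : Fin p, g ⟨i, by omega⟩) + (g ⟨p, by omega⟩ + g ⟨p + 1, by omega⟩)) +
      ∑ j : Fin s, g ⟨p + 2 + j, by omega⟩ := by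
  let G : ℕ → V := fun n => if h : n < N + 1 then g ⟨n, h⟩ else 0
  have hG : ∀ n (h : n < N + 1), g ⟨n, h⟩ = G n := fun n h => by
    simp only [G]
    rw [dif_pos h]
  have h1 : ∑ i, g i = ∑ i : Fin (N + 1), G i := Finset.sum_congr rfl fun i _ => hG i i.2
  rw [h1]
  simp only [hG]
  rw [← Finset.sum_range, ← Finset.sum_range, ← Finset.sum_range (fun j => G (p + 2 + j)), hN,
    Finset.sum_range_add, Finset.sum_range_succ, Finset.sum_range_succ, add_assoc (Finset.sum _ _)]

namespace MultispindleAction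

variable {R : Type uR} [CommRing R] {ι : Type uI} [Fintype ι] {X : Type uX}
  [Multispindle ι X] {M : Type uM} [AddCommGroup M] [Module R M]

/-! ### Chains with a repetition at a given position -/

section DupMap

variable (R M) {p s N : ℕ}

/-- The map `m ⊗ u ↦ m ⊗ (u, y_p, y_p, …, y_0)`. -/
def dupMap (hN : N = p + 2 + s) (y : Fin (p + 1) → X) :
    ((Fin s → X) →₀ M) →ₗ[R] ((Fin N → X) →₀ M) :=
  Finsupp.lmapDomain M R (dupCat hN y)

lemma dupMap_single (hN : N = p + 2 + s) (y : Fin (p + 1) → X) (u : Fin s → X) (m : M) :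
    dupMap R M hN y (Finsupp.single u m) = Finsupp.single (dupCat hN y u) m :=
  Finsupp.mapDomain_single

/-- The coefficient of a chain at the sequences `(u, y_p, y_p, …, y_0)`. -/
def dupCoeff (hN : N = p + 2 + s) (y : Fin (p + 1) → X) :
    ((Fin N → X) →₀ M) →ₗ[R] ((Fin s → X) →₀ M) :=
  Finsupp.lcomapDomain (dupCat hN y) (dupCat_injective hN y)

lemma dupCoeff_apply (hN : N = p + 2 + s) (y : Fin (p + 1) → X) (f : (Fin N → X) →₀ M)
    (u : Fin s → X) : dupCoeff R M hN y f u = f (dupCat hN y u) := rfl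

lemma dupCoeff_dupMap_self (hN : N = p + 2 + s) (y : Fin (p + 1) → X) (c : (Fin s → X) →₀ M) :
    dupCoeff R M hN y (dupMap R M hN y c) = c := by
  ext u
  rw [dupCoeff_apply]
  exact Finsupp.mapDomain_apply (dupCat_injective hN y) c u

lemma dupCoeff_dupMap_of_ne (hN : N = p + 2 + s) {y y' : Fin (p + 1) → X} (h : y ≠ y')
    (c : (Fin s → X) →₀ M) : dupCoeff R M hN y (dupMap R M hN y' c) = 0 := by
  ext u
  rw [dupCoeff_apply]
  refine Finsupp.mapDomain_of_notMem_range c _ ?_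
  rintro ⟨u', e⟩
  exact h (dupCat_inj hN e).1.symm

lemma dupCoeff_eq_zero (hN : N = p + 2 + s) {y : Fin (p + 1) → X} (hy : ¬ HasRepetition y)
    {f : (Fin N → X) →₀ M}
    (hf : f ∈ Finsupp.supported M R {x : Fin N → X | HasRepetitionUpTo ((p : ℤ) - 1) x}) :
    dupCoeff R M hN y f = 0 := by
  ext u
  rw [dupCoeff_apply]
  by_contra hne
  exact hy ((hasRepetitionUpTo_dupCat_iff hN y u).1
    ((Finsupp.mem_supported R f).1 hf (Finsupp.mem_support_iff.2 hne)))

lemma dupMap_mem_supported (hN : N = p + 2 + s) (y : Fin (p + 1) → X) (c : (Fin s → X) →₀ M)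
    (S : Set (Fin N → X)) (hS : ∀ u, dupCat hN y u ∈ S) :
    dupMap R M hN y c ∈ Finsupp.supported M R S := by
  induction c using Finsupp.induction_linear with
  | zero => rw [map_zero]; exact zero_mem _
  | add f g hf hg => rw [map_add]; exact add_mem hf hg
  | single u m =>
    rw [dupMap_single]
    exact Finsupp.single_mem_supported R _ (hS u)

end DupMap

variable (A : MultispindleAction R ι X M) (a : ι → R) {p s N : ℕ}

lemma faceMap_dupMap_upper (k : ι) (hN : N = p + 2 + s) (hN' : N + 1 = p + 2 + (s + 1))
    (y : Fin (p + 1) → X) (c : (Fin (s + 1) → X) →₀ M) (j : Fin (s + 1)) :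
    A.faceMap k ⟨p + 2 + j, by omega⟩ (dupMap R M hN' y c) =
      dupMap R M hN y (A.faceMap k j c) := by
  induction c using Finsupp.induction_linear with
  | zero => simp only [map_zero]
  | add f g hf hg => simp only [map_add, hf, hg]
  | single u m =>
    rw [dupMap_single, faceMap_single, faceMap_single, dupMap_single,
      seqFace_dupCat_upper k hN hN', dupCat_of_gt hN' y u j rfl]

lemma faceMap_dupMap_lower (k : ι) (hN : N = p + 2 + s) (hN' : N + 1 = p + 1 + 2 + s)
    (y : Fin (p + 2) → X) (c : (Fin s → X) →₀ M) (i : Fin (p + 1)) :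
    A.faceMap k ⟨i, by omega⟩ (dupMap R M hN' y c) =
      dupMap R M hN (seqFace k i.castSucc y) (A.chainAct k (y i.castSucc) s c) := by
  induction c using Finsupp.induction_linear with
  | zero => simp only [map_zero]
  | add f g hf hg => simp only [map_add, hf, hg]
  | single u m =>
    rw [dupMap_single, faceMap_single, chainAct_single, dupMap_single,
      seqFace_dupCat_lower k hN hN', dupCat_of_lt hN' y u i.castSucc rfl]

lemma faceMap_dupMap_middle (k : ι) (hN : N + 1 = p + 2 + s) (y : Fin (p + 1) → X)
    (c : (Fin s → X) →₀ M) :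
    A.faceMap k ⟨p, by omega⟩ (dupMap R M hN y c) =
      A.faceMap k ⟨p + 1, by omega⟩ (dupMap R M hN y c) := by
  induction c using Finsupp.induction_linear with
  | zero => simp only [map_zero]
  | add f g hf hg => simp only [map_add, hf, hg]
  | single u m =>
    have e : dupCat hN y u ⟨p, by omega⟩ = dupCat hN y u ⟨p + 1, by omega⟩ := by
      rw [dupCat_of_lt hN y u (Fin.last p) rfl, dupCat_of_eq hN y u rfl]
    rw [dupMap_single, faceMap_single, faceMap_single, e]
    exact congrArg (fun t => Finsupp.single t _)
      (seqFace_repetition k (⟨p, by omega⟩ : Fin N) (dupCat hN y u) e)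

/-- The part of the differential of `m ⊗ (u, y_p, y_p, …, y_0)` given by the faces at `y_i`,
`i < p`. -/
def lowerPart (hN : N + 1 = p + 2 + s) (y : Fin (p + 1) → X) (c : (Fin s → X) →₀ M) :
    (Fin N → X) →₀ M :=
  ∑ i : Fin p, (-1 : R) ^ (N - (i : ℕ)) •
    A.totalFaceMap a ⟨i, by omega⟩ (dupMap R M hN y c)

/-- The two faces at the repetition coincide and have adjacent indices, so their signs are opposite.
-/
lemma differential_dupMap (hN : N + 1 = p + 2 + s) (y : Fin (p + 1) → X) (c : (Fin s → X) →₀ M) :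
    A.differential a N (dupMap R M hN y c) = A.lowerPart a hN y c +
      ∑ j : Fin s, (-1 : R) ^ (N - (p + 2 + j)) •
        A.totalFaceMap a ⟨p + 2 + j, by omega⟩ (dupMap R M hN y c) := by
  simp only [differential, LinearMap.sum_apply, LinearMap.smul_apply]
  rw [sum_fin_eq_lower_add_upper hN]
  have e1 : A.totalFaceMap a ⟨p, by omega⟩ (dupMap R M hN y c) =
      A.totalFaceMap a ⟨p + 1, by omega⟩ (dupMap R M hN y c) := by
    simp only [totalFaceMap, LinearMap.sum_apply, LinearMap.smul_apply, A.faceMap_dupMap_middle]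
  have e2 : N - p = N - (p + 1) + 1 := by omega
  simp only [e1, e2, pow_succ, mul_neg_one, neg_smul, neg_add_cancel, add_zero]
  rfl

lemma differential_dupMap_zero (hN : N + 1 = p + 2 + 0) (y : Fin (p + 1) → X)
    (c : (Fin 0 → X) →₀ M) :
    A.differential a N (dupMap R M hN y c) = A.lowerPart a hN y c := by
  rw [differential_dupMap, Finset.univ_eq_empty, Finset.sum_empty, add_zero]

lemma differential_dupMap_succ (hN : N = p + 2 + s) (hN' : N + 1 = p + 2 + (s + 1))
    (y : Fin (p + 1) → X) (c : (Fin (s + 1) → X) →₀ M) :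
    A.differential a N (dupMap R M hN' y c) = A.lowerPart a hN' y c +
      dupMap R M hN y (A.differential a s c) := by
  rw [differential_dupMap]
  simp only [differential, totalFaceMap, LinearMap.sum_apply, LinearMap.smul_apply, map_sum,
    map_smul, A.faceMap_dupMap_upper _ hN hN']
  -- Signs are counted from the left end, so the upper faces carry exactly the signs of the
  -- differential of `u`.
  have e : ∀ j : Fin (s + 1), N - (p + 2 + j) = s - j := fun j => by omega
  simp only [e]

lemma lowerPart_zero (hN : N + 1 = 0 + 2 + s) (y : Fin (0 + 1) → X) (c : (Fin s → X) →₀ M) :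
    A.lowerPart a hN y c = 0 := by
  rw [lowerPart, Finset.univ_eq_empty, Finset.sum_empty]

lemma lowerPart_succ (hN : N = p + 2 + s) (hN' : N + 1 = p + 1 + 2 + s) (y : Fin (p + 2) → X)
    (c : (Fin s → X) →₀ M) :
    A.lowerPart a hN' y c = ∑ i : Fin (p + 1), (-1 : R) ^ (N - (i : ℕ)) • ∑ k, a k •
      dupMap R M hN (seqFace k i.castSucc y) (A.chainAct k (y i.castSucc) s c) := by
  simp only [lowerPart, totalFaceMap, LinearMap.sum_apply, LinearMap.smul_apply,
    A.faceMap_dupMap_lower _ hN hN']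

/-- Each face below `y_p` moves the repetition from position `p` to `p - 1`. -/
lemma lowerPart_mem (hN : N + 1 = p + 2 + s) (y : Fin (p + 1) → X) (c : (Fin s → X) →₀ M) :
    A.lowerPart a hN y c ∈
      Finsupp.supported M R {x : Fin N → X | HasRepetitionUpTo ((p : ℤ) - 1) x} := by
  cases p with
  | zero =>
    rw [lowerPart_zero]
    exact zero_mem _
  | succ p =>
    rw [A.lowerPart_succ a (by omega) hN]
    refine Submodule.sum_mem _ fun i _ => Submodule.smul_mem _ _
      (Submodule.sum_mem _ fun k _ => Submodule.smul_mem _ _ (dupMap_mem_supported R M _ _ _ _ ?_))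
    intro u
    have := hasRepetitionUpTo_dupCat (by omega : N = p + 2 + s) (seqFace k i.castSucc y) u
    simpa using this

/-- Taking the coefficient at a sequence without repetition commutes with the differential. -/
lemma dupCoeff_differential (hN : N = p + 2 + s) (hN' : N + 1 = p + 2 + (s + 1))
    {y : Fin (p + 1) → X} (hy : ¬ HasRepetition y) {f : (Fin (N + 1) → X) →₀ M}
    (hf : f ∈ Finsupp.supported M R {x : Fin (N + 1) → X | HasRepetitionUpTo (p : ℤ) x}) :
    dupCoeff R M hN y (A.differential a N f) = A.differential a s (dupCoeff R M hN' y f) := by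
  rw [← Finsupp.sum_single f, Finsupp.sum]
  simp only [map_sum]
  refine Finset.sum_congr rfl fun x hx => ?_
  generalize f x = m
  -- A generator of `F^(p-1)` contributes nothing on either side, since `F^(p-1)` is a subcomplex
  -- and `y` has no repetition. Otherwise the repetition is at `p`, and modulo `F^(p-1)` only the
  -- faces at `u` remain.
  rcases hasRepetitionUpTo_cases hN' ((Finsupp.mem_supported R f).1 hf hx) with h | ⟨y', u, rfl⟩
  · have h1 := Finsupp.single_mem_supported R m
      (show x ∈ {x : Fin (N + 1) → X | HasRepetitionUpTo ((p : ℤ) - 1) x} from h)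
    rw [dupCoeff_eq_zero R M hN' hy h1, map_zero,
      dupCoeff_eq_zero R M hN hy (A.differential_mem a _ _ _ h1)]
  · rw [← dupMap_single R M hN' y' u m, A.differential_dupMap_succ a hN hN', map_add,
      dupCoeff_eq_zero R M hN hy (A.lowerPart_mem a hN' _ _), zero_add]
    by_cases h : y = y'
    · subst h
      rw [dupCoeff_dupMap_self, dupCoeff_dupMap_self]
    · rw [dupCoeff_dupMap_of_ne R M hN h, dupCoeff_dupMap_of_ne R M hN' h, map_zero]

/-! ### The compound action on homology vanishes -/

/-- The map `m ⊗ (u_{n-1}, …, u_0) ↦ m ⊗ (u_{n-1}, …, u_0, y)`. -/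
def consMap (y : X) (n : ℕ) : ((Fin n → X) →₀ M) →ₗ[R] ((Fin (n + 1) → X) →₀ M) :=
  Finsupp.lmapDomain M R fun u => (Fin.cons y u : Fin (n + 1) → X)

lemma consMap_single (y : X) (n : ℕ) (u : Fin n → X) (m : M) :
    consMap (R := R) y n (Finsupp.single u m) =
      Finsupp.single (Fin.cons y u : Fin (n + 1) → X) m :=
  Finsupp.mapDomain_single

lemma faceMap_consMap_zero (k : ι) (y : X) (n : ℕ) (c : (Fin n → X) →₀ M) :
    A.faceMap k 0 (consMap (R := R) y n c) = A.chainAct k y n c := by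
  induction c using Finsupp.induction_linear with
  | zero => simp only [map_zero]
  | add f g hf hg => simp only [map_add, hf, hg]
  | single u m =>
    rw [consMap_single, faceMap_single, chainAct_single, seqFace_cons_zero, Fin.cons_zero]

lemma faceMap_consMap_succ (k : ι) (y : X) (n : ℕ) (c : (Fin (n + 1) → X) →₀ M)
    (i : Fin (n + 1)) :
    A.faceMap k i.succ (consMap (R := R) y (n + 1) c) =
      consMap (R := R) y n (A.faceMap k i c) := by
  induction c using Finsupp.induction_linear with
  | zero => simp only [map_zero]
  | add f g hf hg => simp only [map_add, hf, hg]
  | single u m =>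
    rw [consMap_single, faceMap_single, faceMap_single, consMap_single, seqFace_cons_succ,
      Fin.cons_succ]

lemma differential_consMap (y : X) (n : ℕ) (c : (Fin n → X) →₀ M) :
    A.differential a n (consMap (R := R) y n c) = (-1 : R) ^ n • ∑ k, a k • A.chainAct k y n c +
      ∑ i : Fin n, (-1 : R) ^ (n - (i + 1)) • A.totalFaceMap a i.succ (consMap (R := R) y n c) := by
  simp only [differential, LinearMap.sum_apply, LinearMap.smul_apply]
  rw [Fin.sum_univ_succ]
  simp only [totalFaceMap, LinearMap.sum_apply, LinearMap.smul_apply, faceMap_consMap_zero]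
  rfl

lemma differential_consMap_zero (y : X) (c : (Fin 0 → X) →₀ M) :
    A.differential a 0 (consMap (R := R) y 0 c) = ∑ k, a k • A.chainAct k y 0 c := by
  rw [differential_consMap, Finset.univ_eq_empty (α := Fin 0), Finset.sum_empty, add_zero,
    pow_zero, one_smul]

/-- Appending `y` on the right is a contracting homotopy up to sign: the face at `y` gives the
compound action of `y`, and the other faces leave `y` in place. -/
lemma differential_consMap_succ (y : X) (n : ℕ) (c : (Fin (n + 1) → X) →₀ M) :
    A.differential a (n + 1) (consMap (R := R) y (n + 1) c) =
      (-1 : R) ^ (n + 1) • ∑ k, a k • A.chainAct k y (n + 1) c +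
        consMap (R := R) y n (A.differential a n c) := by
  rw [differential_consMap]
  simp only [differential, totalFaceMap, LinearMap.sum_apply, LinearMap.smul_apply, map_sum,
    map_smul, faceMap_consMap_succ, Nat.add_sub_add_right]

/-- The inclusion of the cycles into `M ⊗ R⟨X^n⟩`. -/
def cyclesVal (n : ℕ) : (A.augComplex a).cycles n →ₗ[R] ((Fin n → X) →₀ M) :=
  ((A.augComplex a).iCycles n).hom

lemma augComplex_d_apply (n : ℕ) (x : (A.augComplex a).X (n + 1)) :
    (A.augComplex a).d (n + 1) n x = A.differential a n x := by
  rw [augComplex_d]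
  rfl

lemma differential_cyclesVal (n : ℕ) (z : (A.augComplex a).cycles (n + 1)) :
    A.differential a n (A.cyclesVal a (n + 1) z) = 0 := by
  have := d_iCycles_apply (A.augComplex a) (n + 1) n z
  rw [augComplex_d_apply] at this
  exact this

lemma exists_cyclesVal_eq_zero (x : (Fin 0 → X) →₀ M) : ∃ z, A.cyclesVal a 0 z = x :=
  exists_iCycles_eq (A.augComplex a) 0 (x := x) fun _ =>
    ChainFiltration.d_eq_zero_of_ne (by omega) _

lemma exists_cyclesVal_eq_succ {n : ℕ} {x : (Fin (n + 1) → X) →₀ M}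
    (hx : A.differential a n x = 0) : ∃ z, A.cyclesVal a (n + 1) z = x := by
  refine exists_iCycles_eq (A.augComplex a) (n + 1) (x := x) fun j => ?_
  by_cases h : j + 1 = n + 1
  · obtain rfl : j = n := by omega
    exact (A.augComplex_d_apply a j x).trans hx
  · exact ChainFiltration.d_eq_zero_of_ne h _

lemma homologyπ_eq_zero_iff_cyclesVal (n : ℕ) (z : (A.augComplex a).cycles n) :
    (A.augComplex a).homologyπ n z = 0 ↔
      ∃ w : (Fin (n + 1) → X) →₀ M, A.differential a n w = A.cyclesVal a n z := by
  rw [homologyπ_eq_zero_iff]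
  constructor
  · rintro ⟨j, w, h⟩
    by_cases hj : n + 1 = j
    · subst hj
      rw [augComplex_d_apply] at h
      exact ⟨w, h⟩
    · rw [ChainFiltration.d_eq_zero_of_ne hj] at h
      exact ⟨0, (map_zero _).trans h⟩
  · rintro ⟨w, h⟩
    exact ⟨n + 1, w, (A.augComplex_d_apply a n w).trans h⟩

/-- The action on the cycles of the augmented complex. -/
def cyclesAct (k : ι) (y : X) (n : ℕ) :
    (A.augComplex a).cycles n →ₗ[R] (A.augComplex a).cycles n :=
  (HomologicalComplex.cyclesMap (A.augComplexAct a k y) n).hom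

lemma cyclesVal_cyclesAct (k : ι) (y : X) (n : ℕ) (z : (A.augComplex a).cycles n) :
    A.cyclesVal a n (A.cyclesAct a k y n z) = A.chainAct k y n (A.cyclesVal a n z) := by
  have := congrArg (fun f => f.hom z) (HomologicalComplex.cyclesMap_i (A.augComplexAct a k y) n)
  exact this

lemma homologyπ_cyclesAct (k : ι) (y : X) (n : ℕ) (z : (A.augComplex a).cycles n) :
    (A.augComplex a).homologyπ n (A.cyclesAct a k y n z) =
      (A.homologyAction a n).act k y ((A.augComplex a).homologyπ n z) := by
  have := congrArg (fun f => f.hom z)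
    (HomologicalComplex.homologyπ_naturality (A.augComplexAct a k y) n)
  exact this.symm

/-- The compound action vanishes on the homology of the augmented complex. -/
lemma sum_homologyAction_eq_zero (y : X) (n : ℕ) (h : (A.augComplex a).homology n) :
    ∑ k, a k • (A.homologyAction a n).act k y h = 0 := by
  obtain ⟨z, rfl⟩ := homologyπ_surjective_of_modules _ n h
  simp only [← homologyπ_cyclesAct, ← map_smul, ← map_sum]
  rw [homologyπ_eq_zero_iff_cyclesVal]
  -- Because `z` is a cycle, the boundary of `z` with `y` appended is just `(-1)^n` times the
  -- compound action.
  refine ⟨(-1 : R) ^ n • consMap (R := R) y n (A.cyclesVal a n z), ?_⟩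
  simp only [map_sum, map_smul, cyclesVal_cyclesAct]
  cases n with
  | zero => rw [differential_consMap_zero, pow_zero, one_smul]
  | succ n =>
    rw [differential_consMap_succ, differential_cyclesVal, map_zero, add_zero, smul_smul,
      ← mul_pow, neg_one_mul, neg_neg, one_pow, one_smul]

end MultispindleAction

namespace ChainFiltration

variable {R : Type uR} [CommRing R] {K : ChainComplex (ModuleCat.{v} R) ℕ} (F : ChainFiltration K)

/-- For `r = 1` the conditions on differentials hold automatically, as every `F^p` is a subcomplex:
`B^1_p = F^(p-1) + d F^p`. -/
lemma mem_B_one_iff {p : ℤ} {m n : ℕ} (h : n + 1 = m) {x : K.X n} :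
    x ∈ F.B 1 p n ↔ ∃ u ∈ F.sub (p - 1) n, ∃ w ∈ F.sub p m, x = u + K.d m n w := by
  rw [F.mem_B h]
  constructor
  · rintro ⟨u, hu, w, hw, e⟩
    exact ⟨u, (F.mem_Z.1 hu).1, w, F.sub_mono (by omega) _ (F.mem_Z.1 hw).1, e⟩
  · rintro ⟨u, hu, w, hw, e⟩
    exact ⟨u, F.mem_Z.2 ⟨hu, fun j => F.sub_mono (by omega) _ (F.d_mem hu j)⟩, w,
      F.mem_Z.2 ⟨F.sub_mono (by omega) _ hw, fun j => F.sub_mono (by omega) _ (F.d_mem hw j)⟩, e⟩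

lemma mem_B_one_of_mem {p : ℤ} {n : ℕ} {x : K.X n} (hx : x ∈ F.sub (p - 1) n) : x ∈ F.B 1 p n :=
  (F.mem_B_one_iff rfl).2 ⟨x, hx, 0, zero_mem _, by simp⟩

end ChainFiltration

namespace MultispindleAction

variable {R : Type uR} [CommRing R] {ι : Type uI} [Fintype ι] {X : Type uX}
  [Multispindle ι X] {M : Type uM} [AddCommGroup M] [Module R M]
  (A : MultispindleAction R ι X M) (a : ι → R)

/-! ### Elements of the degenerate and of the normalized complex -/

section Elements

variable {n N : ℕ}

/-- A degenerate chain of degree `n`, as a chain on sequences of length `N = n + 1`. -/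
def degVal (h : N = n + 1) : (A.degenerateComplex a).X n →ₗ[R] ((Fin N → X) →₀ M) :=
  -- The length is free up to a proof of equality, since `p + 2 + s` and `p + (s + 1) + 1` do not
  -- agree definitionally.
  match N, h with
  | _, rfl => (A.degenerateSub a n).subtype

/-- The degenerate chain given by a chain on sequences with a repetition up to `p`. -/
def degLift (h : N = n + 1) (p : ℤ) :
    Finsupp.supported M R {x : Fin N → X | HasRepetitionUpTo p x} →ₗ[R]
      (A.degenerateComplex a).X n :=
  match N, h with
  | _, rfl => Submodule.inclusion (A.repetitionSub_le_degenerateSub a p n)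

lemma degVal_injective (h : N = n + 1) : Function.Injective (A.degVal a h) := by
  subst h
  exact Subtype.val_injective

lemma degVal_degLift (h : N = n + 1) (p : ℤ)
    (f : Finsupp.supported M R {x : Fin N → X | HasRepetitionUpTo p x}) :
    A.degVal a h (A.degLift a h p f) = f := by
  subst h
  rfl

lemma mem_repetitionFiltration_iff (h : N = n + 1) {p : ℤ} {x : (A.degenerateComplex a).X n} :
    x ∈ (A.repetitionFiltration a).sub p n ↔
      A.degVal a h x ∈ Finsupp.supported M R {x : Fin N → X | HasRepetitionUpTo p x} := by
  subst h
  rfl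

lemma degVal_d {m : ℕ} (h : n + 1 = m) (hN : N = n + 1) (hN' : N + 1 = m + 1)
    (x : (A.degenerateComplex a).X m) :
    A.degVal a hN ((A.degenerateComplex a).d m n x) = A.differential a N (A.degVal a hN' x) := by
  subst h
  subst hN
  have e := congrArg (fun f => f.hom x.1) (A.chainComplex_d a n)
  exact e

lemma repetitionFiltration_eq_top (p : ℤ) (n : ℕ) (h : (n : ℤ) ≤ p) :
    (A.repetitionFiltration a).sub p n = ⊤ :=
  eq_top_iff.2 fun x _ =>
    A.repetitionSub_mono a h n (A.degenerateSub_le_repetitionSub a n x.2)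

/-- The projection onto the normalized complex. -/
def normMk (n : ℕ) : ((Fin (n + 1) → X) →₀ M) →ₗ[R] (A.normalizedComplex a).X n :=
  show (A.chainComplex a).X n →ₗ[R] (A.normalizedComplex a).X n from (A.degenerateSub a n).mkQ

lemma normMk_surjective (n : ℕ) : Function.Surjective (A.normMk a n) :=
  Submodule.mkQ_surjective _

lemma normMk_eq_zero_iff (n : ℕ) (f : (Fin (n + 1) → X) →₀ M) :
    A.normMk a n f = 0 ↔ ∀ y, ¬ HasRepetition y → f y = 0 := by
  have h : A.normMk a n f = 0 ↔ f ∈ A.degenerateSub a n := Submodule.Quotient.mk_eq_zero _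
  rw [h]
  refine (Finsupp.mem_supported' R f).trans ?_
  rfl

lemma normalizedComplex_d_normMk (n : ℕ) (f : (Fin (n + 2) → X) →₀ M) :
    (A.normalizedComplex a).d (n + 1) n (A.normMk a (n + 1) f) =
      A.normMk a n (A.differential a (n + 1) f) := by
  have e := congrArg (fun g => A.normMk a n (g.hom f)) (A.chainComplex_d a n)
  exact e

end Elements

/-! ### The first page -/

section FirstPage

variable {p s N : ℕ}

variable (R M) in
/-- The sum of the maps `dupMap`. -/
def dupSum (hN : N = p + 2 + s) :
    ((Fin (p + 1) → X) →₀ ((Fin s → X) →₀ M)) →ₗ[R] ((Fin N → X) →₀ M) :=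
  Finsupp.lsum R fun y => dupMap R M hN y

lemma dupSum_single (hN : N = p + 2 + s) (y : Fin (p + 1) → X) (c : (Fin s → X) →₀ M) :
    dupSum R M hN (Finsupp.single y c) = dupMap R M hN y c := by
  simp [dupSum]

lemma dupSum_mem (hN : N = p + 2 + s) (g : (Fin (p + 1) → X) →₀ ((Fin s → X) →₀ M)) :
    dupSum R M hN g ∈ Finsupp.supported M R {x : Fin N → X | HasRepetitionUpTo (p : ℤ) x} := by
  induction g using Finsupp.induction_linear with
  | zero => rw [map_zero]; exact zero_mem _
  | add f g hf hg => rw [map_add]; exact add_mem hf hg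
  | single y c =>
    rw [dupSum_single]
    exact dupMap_mem_supported R M hN y c _ (hasRepetitionUpTo_dupCat hN y)

lemma dupCoeff_dupSum (hN : N = p + 2 + s) (g : (Fin (p + 1) → X) →₀ ((Fin s → X) →₀ M))
    (y : Fin (p + 1) → X) : dupCoeff R M hN y (dupSum R M hN g) = g y := by
  induction g using Finsupp.induction_linear with
  | zero => simp only [map_zero, Finsupp.coe_zero, Pi.zero_apply]
  | add f g hf hg => rw [map_add, map_add, hf, hg, Finsupp.add_apply]
  | single y' c =>
    rw [dupSum_single]
    by_cases h : y = y'
    · subst h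
      rw [dupCoeff_dupMap_self, Finsupp.single_eq_same]
    · rw [dupCoeff_dupMap_of_ne R M hN h, Finsupp.single_eq_of_ne h]

/-- The quotient `F^p / F^(p-1)` is detected by the coefficients at repetition-free `y`. -/
lemma mem_supported_of_dupCoeff (hN : N = p + 2 + s) {f : (Fin N → X) →₀ M}
    (hf : f ∈ Finsupp.supported M R {x : Fin N → X | HasRepetitionUpTo (p : ℤ) x})
    (h : ∀ y, ¬ HasRepetition y → dupCoeff R M hN y f = 0) :
    f ∈ Finsupp.supported M R {x : Fin N → X | HasRepetitionUpTo ((p : ℤ) - 1) x} := by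
  refine (Finsupp.mem_supported R f).2 fun x hx => ?_
  rcases hasRepetitionUpTo_cases hN ((Finsupp.mem_supported R f).1 hf hx) with h' | ⟨y, u, rfl⟩
  · exact h'
  · refine (hasRepetitionUpTo_dupCat_iff hN y u).2 (by_contra fun hy => ?_)
    have := DFunLike.congr_fun (h y hy) u
    rw [dupCoeff_apply] at this
    exact Finsupp.mem_support_iff.1 hx this

/-- A chain with prescribed coefficients at the sequences without repetitions. -/
lemma exists_finsupp_of_dupCoeff {C : Type*} [Zero C] (hN : N = p + 2 + s)
    (f : (Fin N → X) →₀ M) (P : (Fin (p + 1) → X) → C → Prop)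
    (hP : ∀ y, ¬ HasRepetition y → ∃ c, P y c)
    (hP0 : ∀ y c, dupCoeff R M hN y f = 0 → P y c → c = 0) :
    ∃ g : (Fin (p + 1) → X) →₀ C, ∀ y, ¬ HasRepetition y → P y (g y) := by
  classical
  choose c hc using hP
  -- By `hP0` the choice is zero wherever the coefficient of `f` is, so its support lies among the
  -- finitely many lower parts of sequences in the support of `f`.
  refine ⟨Finsupp.onFinset (f.support.image fun x i => x ⟨i, by omega⟩)
    (fun y => if h : HasRepetition y then 0 else c y h) fun y hy => ?_, fun y hy => ?_⟩
  · by_cases h : HasRepetition y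
    · exact absurd (dif_pos h) hy
    · rw [dif_neg h] at hy
      have h1 : dupCoeff R M hN y f ≠ 0 := fun h0 => hy (hP0 y _ h0 (hc y h))
      obtain ⟨u, hu⟩ := Finsupp.ne_iff.1 h1
      refine Finset.mem_image.2 ⟨dupCat hN y u, Finsupp.mem_support_iff.2 hu, ?_⟩
      funext i
      exact dupCat_of_lt hN y u i rfl
  · rw [Finsupp.onFinset_apply, dif_neg hy]
    exact hc y hy

/-- The chains `m ⊗ (u, y_p, y_p, …, y_0)` where `m ⊗ u` runs through the cycles. -/
def dupCycles (hN : N = p + 2 + s) :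
    ((Fin (p + 1) → X) →₀ (A.augComplex a).cycles s) →ₗ[R] ((Fin N → X) →₀ M) :=
  dupSum R M hN ∘ₗ Finsupp.mapRange.linearMap (A.cyclesVal a s)

lemma dupCycles_single (hN : N = p + 2 + s) (y : Fin (p + 1) → X) (c : (A.augComplex a).cycles s) :
    A.dupCycles a hN (Finsupp.single y c) = dupMap R M hN y (A.cyclesVal a s c) := by
  rw [dupCycles, LinearMap.comp_apply, Finsupp.mapRange.linearMap_apply, Finsupp.mapRange_single,
    dupSum_single]

lemma dupCoeff_dupCycles (hN : N = p + 2 + s)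
    (g : (Fin (p + 1) → X) →₀ (A.augComplex a).cycles s) (y : Fin (p + 1) → X) :
    dupCoeff R M hN y (A.dupCycles a hN g) = A.cyclesVal a s (g y) :=
  dupCoeff_dupSum hN _ y

lemma dupCycles_mem (hN : N = p + 2 + s) (g : (Fin (p + 1) → X) →₀ (A.augComplex a).cycles s) :
    A.dupCycles a hN g ∈
      Finsupp.supported M R {x : Fin N → X | HasRepetitionUpTo (p : ℤ) x} :=
  dupSum_mem hN _

lemma differential_dupMap_cyclesVal (hN : N + 1 = p + 2 + s) (y : Fin (p + 1) → X)
    (c : (A.augComplex a).cycles s) :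
    A.differential a N (dupMap R M hN y (A.cyclesVal a s c)) =
      A.lowerPart a hN y (A.cyclesVal a s c) := by
  cases s with
  | zero => exact A.differential_dupMap_zero a hN y _
  | succ s =>
    rw [A.differential_dupMap_succ a (by omega) hN, differential_cyclesVal, map_zero, add_zero]

lemma differential_dupCycles_mem (hN : N + 1 = p + 2 + s)
    (g : (Fin (p + 1) → X) →₀ (A.augComplex a).cycles s) :
    A.differential a N (A.dupCycles a hN g) ∈
      Finsupp.supported M R {x : Fin N → X | HasRepetitionUpTo ((p : ℤ) - 1) x} := by
  induction g using Finsupp.induction_linear with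
  | zero => rw [map_zero, map_zero]; exact zero_mem _
  | add f g hf hg => rw [map_add, map_add]; exact add_mem hf hg
  | single y c =>
    rw [dupCycles_single, differential_dupMap_cyclesVal]
    exact A.lowerPart_mem a hN y _

/-- The coefficients of an element of `Z^1_p` are cycles. -/
lemma exists_cyclesVal_eq_dupCoeff (hN : N + 1 = p + 2 + s) {f : (Fin (N + 1) → X) →₀ M}
    (hf : f ∈ Finsupp.supported M R {x : Fin (N + 1) → X | HasRepetitionUpTo (p : ℤ) x})
    (hd : A.differential a N f ∈
      Finsupp.supported M R {x : Fin N → X | HasRepetitionUpTo ((p : ℤ) - 1) x})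
    {y : Fin (p + 1) → X} (hy : ¬ HasRepetition y) :
    ∃ c, A.cyclesVal a s c = dupCoeff R M hN y f := by
  cases s with
  | zero => exact A.exists_cyclesVal_eq_zero a _
  | succ s =>
    refine A.exists_cyclesVal_eq_succ a ?_
    rw [← A.dupCoeff_differential a (by omega : N = p + 2 + s) hN hy hf]
    exact dupCoeff_eq_zero R M _ hy hd

/-- The map `dupCycles`, with values in `Z^1_p`. -/
def dupZ (p s : ℕ) : ((Fin (p + 1) → X) →₀ (A.augComplex a).cycles s) →ₗ[R]
    (A.repetitionFiltration a).Z 1 p (p + (s + 1)) :=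
  LinearMap.codRestrict _ (A.degLift a (by omega : p + s + 1 + 1 = p + (s + 1) + 1) p ∘ₗ
    LinearMap.codRestrict _ (A.dupCycles a (by omega)) (A.dupCycles_mem a _)) fun g => by
      refine ChainFiltration.mem_Z_of_succ _ (m := p + (s + 1)) (n := p + s) (by omega) ?_ ?_
      · rw [A.mem_repetitionFiltration_iff a (by omega : p + s + 1 + 1 = p + (s + 1) + 1),
          LinearMap.comp_apply, degVal_degLift]
        exact A.dupCycles_mem a _ g
      · rw [A.mem_repetitionFiltration_iff a (rfl : p + s + 1 = p + s + 1),
          A.degVal_d a (by omega) rfl (by omega), LinearMap.comp_apply, degVal_degLift]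
        exact A.differential_dupCycles_mem a (by omega) g

lemma degVal_dupZ (hN : N = p + 2 + s) (hN' : N = p + (s + 1) + 1)
    (g : (Fin (p + 1) → X) →₀ (A.augComplex a).cycles s) :
    A.degVal a hN' (A.dupZ a p s g) = A.dupCycles a hN g := by
  obtain rfl : N = p + s + 1 + 1 := by omega
  exact A.degVal_degLift a _ _ _

/-- The map from `dupCycles` to the normalized complex of the homology. -/
def dupNorm (p s : ℕ) : ((Fin (p + 1) → X) →₀ (A.augComplex a).cycles s) →ₗ[R]
    ((A.homologyAction a s).normalizedComplex a).X p :=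
  (A.homologyAction a s).normMk a p ∘ₗ
    Finsupp.mapRange.linearMap ((A.augComplex a).homologyπ s).hom

lemma dupNorm_single (y : Fin (p + 1) → X) (c : (A.augComplex a).cycles s) :
    A.dupNorm a p s (Finsupp.single y c) = (A.homologyAction a s).normMk a p
      (Finsupp.single y ((A.augComplex a).homologyπ s c)) := by
  rw [dupNorm, LinearMap.comp_apply, Finsupp.mapRange.linearMap_apply, Finsupp.mapRange_single]

lemma dupNorm_surjective (p s : ℕ) : Function.Surjective (A.dupNorm a p s) :=
  ((A.homologyAction a s).normMk_surjective a p).comp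
    (Finsupp.mapRange_surjective _ (map_zero _) (homologyπ_surjective_of_modules _ s))

lemma dupNorm_eq_zero_iff (g : (Fin (p + 1) → X) →₀ (A.augComplex a).cycles s) :
    A.dupNorm a p s g = 0 ↔ ∀ y, ¬ HasRepetition y → (A.augComplex a).homologyπ s (g y) = 0 :=
  (A.homologyAction a s).normMk_eq_zero_iff a p _

/-- Modulo `F^(p-1)` an element of `Z^1_p` is given by its coefficients at repetition-free `y`, and
these are cycles. -/
lemma exists_sub_dupZ_mem (z : (A.repetitionFiltration a).Z 1 p (p + (s + 1))) :
    ∃ g, (z : (A.degenerateComplex a).X (p + (s + 1))) - A.dupZ a p s g ∈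
      (A.repetitionFiltration a).B 1 p (p + (s + 1)) := by
  have hz := ChainFiltration.mem_Z _ |>.1 z.2
  have hN : p + s + 1 + 1 = p + (s + 1) + 1 := by omega
  have hN' : p + s + 1 + 1 = p + 2 + s := by omega
  have h1 := (A.mem_repetitionFiltration_iff a hN).1 hz.1
  have h2 := (A.mem_repetitionFiltration_iff a (rfl : p + s + 1 = p + s + 1)).1 (hz.2 (p + s))
  rw [A.degVal_d a (by omega) rfl hN] at h2
  obtain ⟨g, hg⟩ := exists_finsupp_of_dupCoeff (R := R) hN' (A.degVal a hN z)
    (fun y c => A.cyclesVal a s c = dupCoeff R M hN' y (A.degVal a hN z))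
    (fun y hy => A.exists_cyclesVal_eq_dupCoeff a hN' h1 h2 hy)
    (fun y c h0 h => iCycles_injective_of_modules (A.augComplex a) s
      ((h.trans h0).trans (map_zero (A.cyclesVal a s)).symm))
  refine ⟨g, ChainFiltration.mem_B_one_of_mem _ ?_⟩
  rw [A.mem_repetitionFiltration_iff a hN, map_sub, A.degVal_dupZ a hN' hN]
  refine mem_supported_of_dupCoeff hN' (sub_mem h1 (A.dupCycles_mem a hN' g)) fun y hy => ?_
  rw [map_sub, dupCoeff_dupCycles, hg y hy, sub_self]

/-- Taking coefficients at a repetition-free `y` kills `F^(p-1)` and commutes with the differential,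
so membership in `F^(p-1) + d F^p` means that each such coefficient bounds in the augmented complex.
-/
lemma dupNorm_eq_zero_iff_dupZ_mem (g : (Fin (p + 1) → X) →₀ (A.augComplex a).cycles s) :
    A.dupNorm a p s g = 0 ↔ (A.dupZ a p s g : (A.degenerateComplex a).X (p + (s + 1))) ∈
      (A.repetitionFiltration a).B 1 p (p + (s + 1)) := by
  have hN : p + s + 1 + 1 = p + (s + 1) + 1 := by omega
  have hN' : p + s + 1 + 1 = p + 2 + s := by omega
  have hW : p + s + 1 + 1 + 1 = p + (s + 1) + 1 + 1 := by omega
  have hW' : p + s + 1 + 1 + 1 = p + 2 + (s + 1) := by omega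
  rw [dupNorm_eq_zero_iff, ChainFiltration.mem_B_one_iff _ rfl]
  constructor
  · intro h
    obtain ⟨W, hW0⟩ := exists_finsupp_of_dupCoeff (R := R) hN' (A.dupCycles a hN' g)
      -- The second clause makes the bounding chain zero for a zero cycle, which keeps the family
      -- finitely supported.
      (fun y (w : (Fin (s + 1) → X) →₀ M) => A.differential a s w = A.cyclesVal a s (g y) ∧
        (A.cyclesVal a s (g y) = 0 → w = 0)) (fun y hy => by
        by_cases h0 : A.cyclesVal a s (g y) = 0
        · exact ⟨0, by rw [map_zero, h0], fun _ => rfl⟩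
        · obtain ⟨w, hw⟩ := (A.homologyπ_eq_zero_iff_cyclesVal a s (g y)).1 (h y hy)
          exact ⟨w, hw, fun h' => absurd h' h0⟩)
      (fun y w h0 hw => hw.2 (by rwa [dupCoeff_dupCycles] at h0))
    let w := A.degLift a hW p ⟨dupSum R M hW' W, dupSum_mem hW' W⟩
    have hw : A.degVal a hW w = dupSum R M hW' W := A.degVal_degLift a _ _ _
    refine ⟨A.dupZ a p s g - (A.degenerateComplex a).d (p + (s + 1) + 1) (p + (s + 1)) w, ?_, w, ?_,
      (sub_add_cancel _ _).symm⟩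
    · rw [A.mem_repetitionFiltration_iff a hN, map_sub, A.degVal_dupZ a hN' hN,
        A.degVal_d a rfl hN hW, hw]
      refine mem_supported_of_dupCoeff hN' (sub_mem (A.dupCycles_mem a hN' g)
        (A.differential_mem a _ _ _ (dupSum_mem hW' W))) fun y hy => ?_
      rw [map_sub, dupCoeff_dupCycles, A.dupCoeff_differential a hN' hW' hy (dupSum_mem hW' W),
        dupCoeff_dupSum, (hW0 y hy).1, sub_self]
    · rw [A.mem_repetitionFiltration_iff a hW, hw]
      exact dupSum_mem hW' W
  · rintro ⟨u, hu, w, hw, e⟩ y hy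
    rw [homologyπ_eq_zero_iff_cyclesVal]
    rw [A.mem_repetitionFiltration_iff a hN] at hu
    rw [A.mem_repetitionFiltration_iff a hW] at hw
    refine ⟨dupCoeff R M hW' y (A.degVal a hW w), ?_⟩
    rw [← A.dupCoeff_differential a hN' hW' hy hw, ← A.degVal_d a rfl hN hW,
      ← dupCoeff_dupCycles A a hN', ← A.degVal_dupZ a hN' hN, e, map_add, map_add,
      dupCoeff_eq_zero R M hN' hy hu, zero_add]

/-- The lower faces of `dupCycles`, as a formal combination of cycles. -/
def lowerCycles (y : Fin (p + 2) → X) (c : (A.augComplex a).cycles s) :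
    (Fin (p + 1) → X) →₀ (A.augComplex a).cycles s :=
  ∑ i : Fin (p + 1), (-1 : R) ^ (p + s + 1 + 1 - (i : ℕ)) • ∑ k, a k •
    Finsupp.single (seqFace k i.castSucc y) (A.cyclesAct a k (y i.castSucc) s c)

lemma dZ_dupZ_single (h : ((p + 1 : ℕ) : ℤ) - 1 = p) (y : Fin (p + 2) → X)
    (c : (A.augComplex a).cycles s) :
    (A.repetitionFiltration a).dZ h (p + 1 + (s + 1)) (p + (s + 1))
      (A.dupZ a (p + 1) s (Finsupp.single y c)) = A.dupZ a p s (A.lowerCycles a y c) := by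
  have hN : p + s + 1 + 1 = p + (s + 1) + 1 := by omega
  have hN' : p + s + 1 + 1 = p + 2 + s := by omega
  have hW : p + s + 1 + 1 + 1 = p + 1 + (s + 1) + 1 := by omega
  have hW' : p + s + 1 + 1 + 1 = p + 1 + 2 + s := by omega
  refine Subtype.ext (A.degVal_injective a hN ?_)
  rw [ChainFiltration.coe_dZ, A.degVal_d a (by omega) hN hW, A.degVal_dupZ a hN' hN,
    A.degVal_dupZ a hW' hW, dupCycles_single, differential_dupMap_cyclesVal,
    A.lowerPart_succ a hN' hW']
  simp only [lowerCycles, map_sum, map_smul, dupCycles_single, cyclesVal_cyclesAct]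

/-- The normalized differential has one face more than `lowerCycles`, the one at the last entry of
`y`. It is the compound action on homology, which is zero. The sign `(-1)^(s+1)` accounts for the `s
+ 1` additional entries, namely `u` and the second copy of the last entry of `y`. -/
lemma dupNorm_lowerCycles (y : Fin (p + 2) → X) (c : (A.augComplex a).cycles s) :
    ((A.homologyAction a s).normalizedComplex a).d (p + 1) p
        (A.dupNorm a (p + 1) s (Finsupp.single y c)) =
      (-1 : R) ^ (s + 1) • A.dupNorm a p s (A.lowerCycles a y c) := by
  rw [dupNorm_single, normalizedComplex_d_normMk, differential]
  simp only [LinearMap.sum_apply, LinearMap.smul_apply, totalFaceMap_single]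
  rw [Fin.sum_univ_castSucc]
  have hlast : ∀ k : ι, seqFace k (Fin.last (p + 1)) y = fun i => y i.castSucc := fun k => by
    funext t
    exact seqFace_of_lt k _ _ t t.2
  have h0 : ∑ k, a k • Finsupp.single (seqFace k (Fin.last (p + 1)) y)
      ((A.homologyAction a s).act k (y (Fin.last (p + 1))) ((A.augComplex a).homologyπ s c)) =
      0 := by
    simp only [hlast, Finsupp.smul_single]
    rw [← Finsupp.single_finsetSum, sum_homologyAction_eq_zero, Finsupp.single_zero]
  rw [h0, smul_zero, add_zero]
  simp only [lowerCycles, map_sum, map_smul, dupNorm_single, homologyπ_cyclesAct, Finset.smul_sum,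
    smul_smul]
  refine Finset.sum_congr rfl fun i _ => Finset.sum_congr rfl fun k _ => ?_
  have e : (-1 : R) ^ (s + 1) * (-1) ^ (p + s + 1 + 1 - (i : ℕ)) = (-1) ^ (p + 1 - (i : ℕ)) := by
    rw [show p + s + 1 + 1 - (i : ℕ) = (s + 1) + (p + 1 - i) by omega, pow_add _ (s + 1) (_ - _),
      ← mul_assoc, ← mul_pow, neg_one_mul, neg_neg, one_pow, one_mul]
  rw [← mul_assoc, e, Fin.val_castSucc]

lemma exists_firstPageMap (p s : ℕ) :
    ∃ θ : (A.repetitionFiltration a).Z 1 p (p + (s + 1)) →ₗ[R]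
        ((A.homologyAction a s).normalizedComplex a).X p,
      Function.Surjective θ ∧ (∀ z, θ z = 0 ↔ (z : (A.degenerateComplex a).X (p + (s + 1))) ∈
        (A.repetitionFiltration a).B 1 p (p + (s + 1))) ∧
      ∀ g, θ (A.dupZ a p s g) = A.dupNorm a p s g := by
  obtain ⟨θ, h1, h2, h3⟩ := exists_linearMap_of_correspondence (A.dupNorm a p s) (A.dupZ a p s)
    (((A.repetitionFiltration a).B 1 p (p + (s + 1))).comap
      ((A.repetitionFiltration a).Z 1 p (p + (s + 1))).subtype) (A.dupNorm_surjective a p s)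
    (A.exists_sub_dupZ_mem a) (A.dupNorm_eq_zero_iff_dupZ_mem a)
  refine ⟨θ, h1, fun z => ?_, h3⟩
  rw [← LinearMap.mem_ker, h2]
  rfl

end FirstPage

/-! ### The second page -/

lemma nonempty_secondPageIso_succ (p s : ℕ) :
    Nonempty (((A.repetitionFiltration a).page 2).X (p, s + 1) ≅
      (A.homologyAction a s).normalizedHomology a p) := by
  choose θ h1 h2 h3 using A.exists_firstPageMap a
  refine (A.repetitionFiltration a).nonempty_secondPageIso (A.repetitionFiltration_eq_top a)
    (s + 1) ((A.homologyAction a s).normalizedComplex a) ((-1) ^ (s + 1))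
    (by rw [← mul_pow, neg_one_mul, neg_neg, one_pow]) (fun p => θ p s) (fun p => h1 p s)
    (fun p => h2 p s) (fun p h z => ?_) p
  have key : ∀ g, ((A.homologyAction a s).normalizedComplex a).d (p + 1) p
      (A.dupNorm a (p + 1) s g) = (-1 : R) ^ (s + 1) • θ p s ((A.repetitionFiltration a).dZ h
        (p + 1 + (s + 1)) (p + (s + 1)) (A.dupZ a (p + 1) s g)) := fun g => by
    induction g using Finsupp.induction_linear with
    | zero => simp only [map_zero, smul_zero]
    | add f g hf hg => simp only [map_add, hf, hg, smul_add]
    | single y c => rw [dZ_dupZ_single, h3, dupNorm_lowerCycles]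
  -- The compatibility `key` on the image of `dupZ` suffices: the remainder `b` lies in `B^1`, which
  -- the differential preserves and `θ` kills.
  obtain ⟨g, hg⟩ := A.exists_sub_dupZ_mem a z
  obtain ⟨b, hb⟩ : ∃ b, z - A.dupZ a (p + 1) s g = b := ⟨_, rfl⟩
  have hb' : (b : (A.degenerateComplex a).X (p + 1 + (s + 1))) ∈
      (A.repetitionFiltration a).B 1 (p + 1 : ℕ) (p + 1 + (s + 1)) := hb ▸ hg
  rw [sub_eq_iff_eq_add] at hb
  have e1 : θ (p + 1) s b = 0 := (h2 _ _ _).2 hb'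
  have e2 : θ p s ((A.repetitionFiltration a).dZ h _ _ b) = 0 :=
    (h2 _ _ _).2 (ChainFiltration.d_B_mem_B _ h hb' _)
  rw [hb, map_add, map_add, map_add, map_add, e1, e2, map_zero, zero_add, zero_add, h3, key]

/-- Both sides are zero. In degree `p` a repetition needs `i + 1 ≤ p`, so `F^p` equals `F^(p-1)`
there and the row `q = 0` already vanishes on the first page. -/
lemma nonempty_secondPageIso_zero {N : Type (max uX uM)} [AddCommGroup N] [Module R N]
    [Subsingleton N] (B : MultispindleAction R ι X N) (p : ℕ) :
    Nonempty (((A.repetitionFiltration a).page 2).X (p, 0) ≅ B.normalizedHomology a p) := by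
  have hsub : ∀ p (x : (B.normalizedComplex a).X p), x = 0 := fun p x => by
    obtain ⟨f, rfl⟩ := B.normMk_surjective a p x
    rw [Subsingleton.elim f 0, map_zero]
  refine (A.repetitionFiltration a).nonempty_secondPageIso (A.repetitionFiltration_eq_top a)
    0 (B.normalizedComplex a) 1 (one_mul 1) (fun p => 0)
    (fun p x => ⟨0, (hsub p _).trans (hsub p x).symm⟩) (fun p z => ⟨fun _ => ?_, fun _ => hsub p _⟩)
    (fun p h z => (hsub p _).trans (hsub p _).symm) p
  refine ChainFiltration.mem_B_one_of_mem _ ?_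
  have hz := ((ChainFiltration.mem_Z _).1 z.2).1
  rw [A.mem_repetitionFiltration_iff a (n := p + 0) rfl] at hz ⊢
  refine Finsupp.supported_mono ?_ hz
  rintro x ⟨i, -, hi, e⟩
  exact ⟨i, by omega, hi, e⟩

/-- The degree `k` is a variable so that it can be replaced by a constructor of `ℤ`, on which
`augHomologyAction` reduces. -/
lemma nonempty_secondPageIso_of_eq (p s : ℕ) (k : ℤ) (hk : k = (s : ℤ) - 1) :
    Nonempty (((A.repetitionFiltration a).page 2).X (p, s + 1) ≅
      (A.augHomologyAction a k).normalizedHomology a p) := by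
  cases s with
  | zero =>
    obtain rfl : k = Int.negSucc 0 := by omega
    exact A.nonempty_secondPageIso_succ a p 0
  | succ s =>
    obtain rfl : k = Int.ofNat s := by
      rw [Int.ofNat_eq_natCast]
      omega
    exact A.nonempty_secondPageIso_succ a p (s + 1)

lemma subsingleton_augHomology {k : ℤ} (hk : k = -2) : Subsingleton (A.augHomology a k) := by
  obtain rfl : k = Int.negSucc 1 := hk
  exact inferInstanceAs (Subsingleton PUnit)

end MultispindleAction

end

theorem theorem5p4 {R : Type uR} [CommRing R] {ι : Type uI} [Fintype ι] {X : Type uX}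
    [Multispindle ι X] {M : Type uM} [AddCommGroup M] [Module R M]
    (A : MultispindleAction R ι X M) (a : ι → R) :
    ∃ (E : FirstQuadrantSpectralSequence.{uR, max uX uM} R)
      (hE : (A.repetitionFiltration a).IsSpectralSequence E),
      (A.repetitionFiltration a).ConvergesToHomology hE ∧
      ∀ p q : ℕ, Nonempty ((E.page 2 int_zero_le_two).X (p, q) ≅
        (A.augHomologyAction a ((q : ℤ) - 2)).normalizedHomology a p) := by
  refine ⟨(A.repetitionFiltration a).spectralSequence (A.repetitionFiltration_eq_top a),
    (A.repetitionFiltration a).isSpectralSequence (A.repetitionFiltration_eq_top a),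
    (A.repetitionFiltration a).convergesToHomology (A.repetitionFiltration_eq_top a),
    fun p q => ?_⟩
  cases q with
  | zero =>
    have := A.subsingleton_augHomology a (k := ((0 : ℕ) : ℤ) - 2) (by norm_num)
    exact A.nonempty_secondPageIso_zero a _ p
  | succ s => exact A.nonempty_secondPageIso_of_eq a p s _ (by push_cast; omega)
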